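/- Cover the plane by the unit square grid with vertices $\mathbb Z^2$. All its unit edges (the walls) are solid at the start. A particle moves in straight lines; whenever it reaches a solid wall it is reflected there and that wall (and no other) is erased; walls already erased are passed through; if the particle ever reaches a vertex of the grid (a corner), it stops. Let $w_0,w_1,w_2,\dots$ be the walls that it collides with. A band is the set of points within some given distance $\varepsilon>0$ of some ray. The particle tunnels if it never hits a corner and, for some $r$, all the walls $w_n$ outside the disc of radius $r$ about the origin are contained in a finite union of bands, each of these walls in one of the bands. The tunnel is periodic if there is an integer $k\ge 1$ such that, for all sufficiently large $r$, one can choose such bands, their number being the least possible for which the particle tunnels, so that for every $n$ with $w_n$ outside the disc the walls $w_{n+k}$ and $w_n$ are of the same type (both horizontal or both vertical), and the displacement from $w_n$ to $w_{n+k}$ depends only on which band contains $w_n$. The least such $k$ is the period of the tunnel. Theorem. Let $P$ be any point of the interior $(0,1)\times(0,1)$ of the unit square. For every $N\in\mathbb N$ and every $\delta>0$ there is a rational slope $s$ with $3<s<3+\delta$ such that the particle started at $P$, heading up and to the right with slope $s$, never hits a corner and digs a periodic tunnel of period at least $N$; moreover the cutting sequence of $s$ from $P$ (the sequence of the types, horizontal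 or vertical, of the grid lines crossed by the straight half-line from $P$ in the direction $(1,s)$) exists, that is, this half-line passes through no vertex of the grid, and it is periodic with least period at least $N$. -/

import Mathlib

namespace BombBilliards

/-- The Euclidean plane; the coordinates of a point `p` are `p 0` and `p 1`. -/
abbrev Plane : Type := EuclideanSpace ℝ (Fin 2)

/-- `z` is an integer. -/
def IsInt (z : ℝ) : Prop := ∃ n : ℤ, z = n

/-- The two types of unit edges of the square grid. -/
inductive WallType : Type where
  | horizontal : WallType
  | vertical : WallType

/-- A wall, that is, a unit edge of the square grid, given by its type and by its left endpoint
(if it is horizontal) or its lower endpoint (if it is vertical). -/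
structure Wall : Type where
  type : WallType
  base : ℤ × ℤ

/-- The closed segment occupied by a wall. -/
def Wall.segment (w : Wall) : Set Plane :=
  match w.type with
  | WallType.horizontal =>
      {p | (w.base.1 : ℝ) ≤ p 0 ∧ p 0 ≤ (w.base.1 : ℝ) + 1 ∧ p 1 = (w.base.2 : ℝ)}
  | WallType.vertical =>
      {p | p 0 = (w.base.1 : ℝ) ∧ (w.base.2 : ℝ) ≤ p 1 ∧ p 1 ≤ (w.base.2 : ℝ) + 1}

/-- A corner is a vertex of the grid. -/
def IsCorner (p : Plane) : Prop := IsInt (p 0) ∧ IsInt (p 1)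

/-- A velocity vector after reflection in a wall of the given type. -/
def reflect (o : WallType) (v : Plane) : Plane :=
  match o with
  | WallType.horizontal => !₂[v 0, -(v 1)]
  | WallType.vertical => !₂[-(v 0), v 1]

/-- A state of the system: position and velocity of the particle, and the set of walls that are
still solid. -/
structure State : Type where
  pos : Plane
  vel : Plane
  solid : Set Wall

/-- From the state `S` the particle moves in a straight line until it collides with the solid wall
`w`, without having met a corner (whether or not walls are left there); it is reflected there and
erases exactly the wall `w` (single-wall bomb); `S'` is the state right after the collision. -/
def Collides (S : State) (w : Wall) (S' : State) : Prop :=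
  ∃ t : ℝ, 0 < t ∧ w ∈ S.solid ∧ S.pos + t • S.vel ∈ w.segment ∧
    (∀ u : ℝ, 0 < u → u ≤ t → ¬ IsCorner (S.pos + u • S.vel)) ∧
    (∀ u : ℝ, 0 < u → u < t → ∀ w' ∈ S.solid, S.pos + u • S.vel ∉ w'.segment) ∧
    S' = ⟨S.pos + t • S.vel, reflect w.type S.vel, S.solid \ {w}⟩

/-- `w 0, w 1, w 2, …` is the infinite sequence of the walls collided with by the particle that
starts at `P`, heading up and to the right with slope `s`, when all walls are solid at the start.
(Such a sequence is unique; there is none if the particle ever hits a corner.) -/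
def IsCollisionSequence (P : Plane) (s : ℝ) (w : ℕ → Wall) : Prop :=
  ∃ S : ℕ → State, S 0 = ⟨P, !₂[1, s], Set.univ⟩ ∧ ∀ n, Collides (S n) (w n) (S (n + 1))

/-- A band: the points within the distance `width` of the ray from `start` in the direction
`dir`. -/
structure Band : Type where
  start : Plane
  dir : Plane
  dir_ne_zero : dir ≠ 0
  width : ℝ
  width_pos : 0 < width

/-- The points of a band. -/
def Band.points (B : Band) : Set Plane :=
  {p | ∃ t : ℝ, 0 ≤ t ∧ dist p (B.start + t • B.dir) ≤ B.width}

/-- The wall lies outside the disc of radius `r` about the origin. -/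
def Wall.OutsideDisc (w : Wall) (r : ℝ) : Prop := ∀ p ∈ w.segment, r < ‖p‖

/-- Every wall collided with outside the disc of radius `r` is contained in one of the bands. -/
def Covers (w : ℕ → Wall) (r : ℝ) {m : ℕ} (B : Fin m → Band) : Prop :=
  ∀ n, (w n).OutsideDisc r → ∃ i, (w n).segment ⊆ (B i).points

/-- Outside some disc, all walls collided with are contained in `m` bands. -/
def TunnelsInBands (w : ℕ → Wall) (m : ℕ) : Prop :=
  ∃ (r : ℝ) (B : Fin m → Band), Covers w r B

/-- The particle tunnels: outside some disc, all walls collided with are contained in a finite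
union of bands. -/
def Tunnels (w : ℕ → Wall) : Prop := ∃ m, TunnelsInBands w m

/-- `k` is an admissible shift for the tunnel: the bands of the tunnel being as few as possible
(one band for a unidirectional tunnel, two for a bidirectional one), for every sufficiently
large `r` and every collision `n` with a wall outside the disc of radius `r`, the wall of collision
`n + k` has the same type as the wall of collision `n`, and the displacement from the one to the
other depends only on the band which contains the wall of collision `n`. -/
def IsShift (w : ℕ → Wall) (k : ℕ) : Prop :=
  0 < k ∧ ∃ m, IsLeast {m | TunnelsInBands w m} m ∧
    ∃ R : ℝ, ∀ r, R ≤ r → ∃ B : Fin m → Band, Covers w r B ∧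
      ∃ d : Fin m → ℤ × ℤ, ∀ n, (w n).OutsideDisc r →
        (w (n + k)).type = (w n).type ∧
        ∀ i, (w n).segment ⊆ (B i).points → (w (n + k)).base - (w n).base = d i

/-- The particle digs a periodic tunnel of period `k` (the least admissible shift). -/
def DigsPeriodicTunnel (w : ℕ → Wall) (k : ℕ) : Prop :=
  Tunnels w ∧ IsLeast {k | IsShift w k} k

/-- `c` is the cutting sequence of the straight half-line from `P` with slope `s`, heading up and
to the right: `c 0, c 1, c 2, …` are the types of the grid lines which it crosses, in this order.
(There is none if the half-line passes through a corner.) -/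
def IsCuttingSequence (P : Plane) (s : ℝ) (c : ℕ → WallType) : Prop :=
  ∃ τ : ℕ → ℝ, StrictMono τ ∧
    Set.range τ = {t | 0 < t ∧ (IsInt (P 0 + t) ∨ IsInt (P 1 + t * s))} ∧
    ∀ n, (c n = WallType.vertical ↔ IsInt (P 0 + τ n)) ∧
      (c n = WallType.horizontal ↔ IsInt (P 1 + τ n * s))

/-- `q` is the least period of the sequence `c`. -/
def IsLeastPeriod (c : ℕ → WallType) (q : ℕ) : Prop :=
  IsLeast {q | 0 < q ∧ Function.Periodic c q} q

end BombBilliards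

/-!
# Slopes slightly above `3` dig long periodic tunnels

Take `s = 3 + 1 / q` with `q` large. Unfolding the reflections turns the path of the particle into
the straight half-line from `P` of slope `s`, and its fate depends only on the cutting sequence of
this half-line: at every letter there is a wall ahead, which is either gone, and the particle passes
into the next cell, or solid, and the particle is reflected and the wall erased (`Cfg.step`;
`IsGeneric.collides` translates this back into geometry). One of the slopes for `q` and `q + 1` leads
to no vertex (`isGeneric_or`).

The cutting sequence is `Hᵃ V B ⋯ B` followed by infinitely many copies of `H B^q`, where `B = HHHV`
and `a ≤ 3` (`reads_of_slope`). Its period `4 * q + 1` is the least one because it is coprime to the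
number `q` of letters `V` in it (`isLeastPeriod`).

While only blocks `B` are read, the particle soon digs a straight tunnel in a diagonal direction:
after every three blocks and six collisions the surroundings of the particle look as before, moved by
one cell both horizontally and vertically (`models_start`, `leads_cycle`). The additional `H` in
`H B^q` can occur in three phases of this motion. In each of them it is followed by a disturbance of
about twenty blocks, after which the particle digs on in the same direction but displaced from the
old diagonal by one cell (`leads_extra`). So after three copies of `H B^q` the phase recurs and the
whole future repeats itself up to a translation `D` off the diagonal (`leads_three_words`). These
facts about finitely many letters are verified by computation with the finitely many walls in a
half-plane around the particle; what is further behind is never met again.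

Hence the walls hit are eventually periodic up to `D`, and one band along `D` contains them all. An
admissible shift `k` has a constant displacement `d`. If `k` were small compared to `q`, comparison
inside a long straight part would give `6 d = k (1, 1)`, up to signs, and comparison over many
periods would make `d` parallel to `D`, a contradiction (`digs_of_reads`).
-/

namespace BombBilliards

/-! ### The combinatorial system -/

/-- A configuration of the combinatorial system. The plane is scaled by two, so that cells and walls
are given by their midpoints, which are integer points: `pos` is the cell that the particle is in
(both coordinates odd), `erased` is the set of the walls that are gone (one coordinate odd, one
even), and `dir` holds the signs of the two components of the velocity. Reflections and
translations of the grid then act by affine maps on all of these alike, see `place`. -/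
structure Cfg : Type where
  pos : ℤ × ℤ
  dir : ℤ × ℤ
  erased : Set (ℤ × ℤ)

/-- The point `k` steps ahead of `p`, along the horizontal axis for the letter `true` (a vertical
line is crossed) and along the vertical axis for `false`; the wall ahead is at `k = 1`, the next
cell at `k = 2`. -/
def ahead (p d : ℤ × ℤ) (b : Bool) (k : ℤ) : ℤ × ℤ :=
  bif b then (p.1 + k * d.1, p.2) else (p.1, p.2 + k * d.2)

/-- The direction after reflection at a wall of the type given by the letter. -/
def flipDir (d : ℤ × ℤ) (b : Bool) : ℤ × ℤ := bif b then (-d.1, d.2) else (d.1, -d.2)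

/-- The wall that the particle meets at the letter `b`. -/
def Cfg.front (S : Cfg) (b : Bool) : ℤ × ℤ := ahead S.pos S.dir b 1

open Classical in
/-- One letter of the cutting sequence: the particle passes into the next cell if the wall ahead is
gone; otherwise it is reflected and erases that wall. -/
noncomputable def Cfg.step (S : Cfg) (b : Bool) : Cfg :=
  if S.front b ∈ S.erased then ⟨ahead S.pos S.dir b 2, S.dir, S.erased⟩
  else ⟨S.pos, flipDir S.dir b, insert (S.front b) S.erased⟩

/-- The configuration after a finite word. -/
noncomputable def Cfg.run : List Bool → Cfg → Cfg
  | [], S => S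
  | b :: l, S => Cfg.run l (S.step b)

open Classical in
/-- The walls erased while a finite word is read, in order. -/
noncomputable def Cfg.hits : List Bool → Cfg → List (ℤ × ℤ)
  | [], _ => []
  | b :: l, S => if S.front b ∈ S.erased then Cfg.hits l (S.step b)
      else S.front b :: Cfg.hits l (S.step b)

theorem Cfg.run_append (l l' : List Bool) (S : Cfg) :
    Cfg.run (l ++ l') S = Cfg.run l' (Cfg.run l S) := by
  induction l generalizing S with
  | nil => rfl
  | cons b l ih => exact ih _

theorem Cfg.hits_append (l l' : List Bool) (S : Cfg) :
    Cfg.hits (l ++ l') S = Cfg.hits l S ++ Cfg.hits l' (Cfg.run l S) := by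
  induction l generalizing S with
  | nil => rfl
  | cons b l ih =>
    simp only [List.cons_append, Cfg.hits, Cfg.run, ih]
    split_ifs <;> simp

/-- A configuration whose erased walls are listed, for computations. -/
structure FinCfg : Type where
  pos : ℤ × ℤ
  dir : ℤ × ℤ
  erased : List (ℤ × ℤ)

/-- The half-plane in which a finite configuration describes the walls faithfully. The offset `11` is
large enough for the steady configurations below to determine all that follows. -/
def InWindow (e : ℤ × ℤ) : Prop := -11 ≤ e.1 + e.2

instance : DecidablePred InWindow := fun e => inferInstanceAs (Decidable (-11 ≤ e.1 + e.2))

/-- Reads a word from a finite configuration and lists the walls erased; the value is `none` if a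
wall outside the window is consulted. -/
def FinCfg.run : List Bool → FinCfg → Option (FinCfg × List (ℤ × ℤ))
  | [], T => some (T, [])
  | b :: l, T =>
    if InWindow (ahead T.pos T.dir b 1) then
      if ahead T.pos T.dir b 1 ∈ T.erased then
        FinCfg.run l ⟨ahead T.pos T.dir b 2, T.dir, T.erased⟩
      else
        (FinCfg.run l ⟨T.pos, flipDir T.dir b, ahead T.pos T.dir b 1 :: T.erased⟩).map
          fun r => (r.1, ahead T.pos T.dir b 1 :: r.2)
    else none

/-- The affine map `e ↦ O + σ e`; for signs `σ` it is a symmetry of the grid. -/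
def place (O σ e : ℤ × ℤ) : ℤ × ℤ := (O.1 + σ.1 * e.1, O.2 + σ.2 * e.2)

/-- `S` looks like the image of `T` under `e ↦ O + σ e`, as far as the window shows. -/
structure Models (O σ : ℤ × ℤ) (S : Cfg) (T : FinCfg) : Prop where
  ne₁ : σ.1 ≠ 0
  ne₂ : σ.2 ≠ 0
  pos : S.pos = place O σ T.pos
  dir : S.dir = (σ.1 * T.dir.1, σ.2 * T.dir.2)
  erased : ∀ e, InWindow e → (place O σ e ∈ S.erased ↔ e ∈ T.erased)

theorem place_inj {O σ e e' : ℤ × ℤ} (h₁ : σ.1 ≠ 0) (h₂ : σ.2 ≠ 0) :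
    place O σ e = place O σ e' ↔ e = e' := by
  constructor
  · intro h
    simp only [place, Prod.mk.injEq, add_right_inj, mul_eq_mul_left_iff, h₁, h₂, or_false] at h
    exact Prod.ext h.1 h.2
  · rintro rfl; rfl

theorem ahead_place (O σ p d : ℤ × ℤ) (b : Bool) (k : ℤ) :
    ahead (place O σ p) (σ.1 * d.1, σ.2 * d.2) b k = place O σ (ahead p d b k) := by
  cases b <;> simp [ahead, place] <;> ring

/-- A computation that stays inside the window is carried out alike by every configuration modelled
on it. -/
theorem Models.run {O σ : ℤ × ℤ} {l : List Bool} {S : Cfg} {T T' : FinCfg} {G : List (ℤ × ℤ)}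
    (h : Models O σ S T) (hr : T.run l = some (T', G)) :
    Models O σ (Cfg.run l S) T' ∧ Cfg.hits l S = G.map (place O σ) := by
  induction l generalizing S T T' G with
  | nil =>
    simp only [FinCfg.run, Option.some.injEq, Prod.mk.injEq] at hr
    obtain ⟨rfl, rfl⟩ := hr
    exact ⟨h, rfl⟩
  | cons b l ih =>
    have hf : S.front b = place O σ (ahead T.pos T.dir b 1) := by
      rw [Cfg.front, h.pos, h.dir, ahead_place]
    simp only [FinCfg.run] at hr
    split_ifs at hr with hw he
    · have hS : S.front b ∈ S.erased := by rw [hf, h.erased _ hw]; exact he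
      have hm : Models O σ (S.step b) ⟨ahead T.pos T.dir b 2, T.dir, T.erased⟩ := by
        rw [Cfg.step, if_pos hS]
        exact ⟨h.ne₁, h.ne₂, by simp only [h.pos, h.dir, ahead_place], h.dir, h.erased⟩
      obtain ⟨h1, h2⟩ := ih hm hr
      exact ⟨h1, by rw [Cfg.hits, if_pos hS, h2]⟩
    · have hS : S.front b ∉ S.erased := by rw [hf, h.erased _ hw]; exact he
      rw [Option.map_eq_some_iff] at hr
      obtain ⟨⟨T₁, G₁⟩, hr, h3⟩ := hr
      simp only [Prod.mk.injEq] at h3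
      obtain ⟨rfl, rfl⟩ := h3
      have hm : Models O σ (S.step b)
          ⟨T.pos, flipDir T.dir b, ahead T.pos T.dir b 1 :: T.erased⟩ := by
        rw [Cfg.step, if_neg hS]
        refine ⟨h.ne₁, h.ne₂, h.pos, ?_, ?_⟩
        · rw [h.dir]; cases b <;> simp [flipDir]
        · intro e he'
          simp only [Set.mem_insert_iff, List.mem_cons, hf, place_inj h.ne₁ h.ne₂, h.erased e he']
      obtain ⟨h1, h2⟩ := ih hm hr
      exact ⟨h1, by rw [Cfg.hits, if_neg hS, h2, hf]; rfl⟩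

/-- Seen through the window of `T'` translated by `δ`, the configuration `T` is `T'` translated
by `δ`. The condition on `δ` says that the translated window lies inside the window of `T`. -/
def FinCfg.Agrees (T : FinCfg) (δ : ℤ × ℤ) (T' : FinCfg) : Prop :=
  T.pos = T'.pos + δ ∧ T.dir = T'.dir ∧ 0 ≤ δ.1 + δ.2 ∧
    (∀ e ∈ T.erased, InWindow (e - δ) → e - δ ∈ T'.erased) ∧ ∀ e ∈ T'.erased, e + δ ∈ T.erased

instance (T : FinCfg) (δ : ℤ × ℤ) (T' : FinCfg) : Decidable (T.Agrees δ T') :=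
  inferInstanceAs (Decidable (_ ∧ _))

theorem place_place (O σ δ e : ℤ × ℤ) : place (place O σ δ) σ e = place O σ (e + δ) := by
  simp only [place, Prod.fst_add, Prod.snd_add, Prod.mk.injEq]; constructor <;> ring

theorem Models.shift {O σ δ : ℤ × ℤ} {S : Cfg} {T T' : FinCfg} (h : Models O σ S T)
    (ha : T.Agrees δ T') : Models (place O σ δ) σ S T' := by
  obtain ⟨h1, h2, h3, h4, h5⟩ := ha
  refine ⟨h.ne₁, h.ne₂, by rw [h.pos, h1, place_place], by rw [h.dir, h2], fun e he => ?_⟩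
  have hw : InWindow (e + δ) := by
    simp only [InWindow, Prod.fst_add, Prod.snd_add] at he ⊢; omega
  rw [place_place, h.erased _ hw]
  refine ⟨fun h' => ?_, h5 e⟩
  have := h4 _ h'
  rw [add_sub_cancel_right] at this
  exact this he

/-! ### Straight digging and its disturbances -/

/-- The three configurations through which the particle passes cyclically while it digs straight
along the diagonal; one block of letters leads from each to the next. -/
def steady : Fin 3 → FinCfg
  | 0 => ⟨(0, 0), (-1, 1), [(-6, -5), (-5, -6), (-4, -7), (-4, -5), (-4, -3), (-3, -6), (-3, -4),
      (-2, -7), (-2, -5), (-2, -3), (-2, -1), (-1, -2), (0, -3), (0, -1), (1, 0)]⟩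
  | 1 => ⟨(0, -4), (1, -1), [(-6, -5), (-5, -6), (-4, -7), (-4, -5), (-4, -3), (-3, -6), (-3, -4),
      (-2, -7), (-2, -5), (-2, -3), (-2, -1), (-1, -4), (-1, -2), (0, -3), (0, -1), (0, 1),
      (1, 0)]⟩
  | 2 => ⟨(2, 0), (1, 1), [(-6, -5), (-5, -6), (-4, -7), (-4, -5), (-4, -3), (-3, -6), (-3, -4),
      (-2, -7), (-2, -5), (-2, -3), (-2, -1), (-1, -4), (-1, -2), (0, -5), (0, -3), (0, -1),
      (0, 1), (1, 0)]⟩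

/-- The word `(HHHV)ⁿ`. -/
def blocks (n : ℕ) : List Bool := (List.replicate n [false, false, false, true]).flatten

theorem blocks_add (m n : ℕ) : blocks (m + n) = blocks m ++ blocks n := by
  rw [blocks, List.replicate_add, List.flatten_append]; rfl

theorem length_blocks (n : ℕ) : (blocks n).length = 4 * n := by
  simp [blocks, mul_comm]

/-- Every configuration that looks like the steady configuration `φ` is taken by the word `l` to one
that looks like the steady configuration `ψ`, displaced by `δ`, and erases the walls `G` on its
way, all in the coordinates in which it looks like `φ`. -/
def Leads (φ : Fin 3) (l : List Bool) (ψ : Fin 3) (δ : ℤ × ℤ) (G : List (ℤ × ℤ)) : Prop :=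
  ∀ O σ S, Models O σ S (steady φ) →
    Models (place O σ δ) σ (Cfg.run l S) (steady ψ) ∧ Cfg.hits l S = G.map (place O σ)

theorem Leads.trans {φ ψ χ : Fin 3} {l l' : List Bool} {δ δ' : ℤ × ℤ} {G G' : List (ℤ × ℤ)}
    (h : Leads φ l ψ δ G) (h' : Leads ψ l' χ δ' G') :
    Leads φ (l ++ l') χ (δ + δ') (G ++ G'.map (· + δ)) := by
  intro O σ S hS
  obtain ⟨h1, h2⟩ := h O σ S hS
  obtain ⟨h3, h4⟩ := h' _ _ _ h1
  rw [Cfg.run_append, Cfg.hits_append, h2, h4, List.map_append, List.map_map]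
  rw [place_place, add_comm] at h3
  refine ⟨h3, ?_⟩
  congr 1
  exact List.map_congr_left fun e _ => place_place _ _ _ _

/-- The walls erased when `l` is read from `T`. -/
def FinCfg.output (T : FinCfg) (l : List Bool) : List (ℤ × ℤ) :=
  match T.run l with
  | some (_, G) => G
  | none => []

/-- Reading `l` from `T` stays inside the window and ends at `T'` displaced by `δ`. -/
def FinCfg.Reaches (T : FinCfg) (l : List Bool) (δ : ℤ × ℤ) (T' : FinCfg) : Prop :=
  match T.run l with
  | some (T₁, _) => T₁.Agrees δ T'
  | none => False

instance (T : FinCfg) (l : List Bool) (δ : ℤ × ℤ) (T' : FinCfg) : Decidable (T.Reaches l δ T') := by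
  unfold FinCfg.Reaches
  split <;> infer_instance

theorem Models.reaches {O σ δ : ℤ × ℤ} {l : List Bool} {S : Cfg} {T T' : FinCfg}
    (h : Models O σ S T) (hr : T.Reaches l δ T') :
    Models (place O σ δ) σ (Cfg.run l S) T' ∧ Cfg.hits l S = (T.output l).map (place O σ) := by
  unfold FinCfg.Reaches at hr
  unfold FinCfg.output
  split at hr
  · next T₁ G heq =>
    obtain ⟨h1, h2⟩ := h.run heq
    exact ⟨h1.shift hr, h2⟩
  · exact hr.elim

theorem leads_of_reaches {φ ψ : Fin 3} {l : List Bool} {δ : ℤ × ℤ}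
    (h : (steady φ).Reaches l δ (steady ψ)) : Leads φ l ψ δ ((steady φ).output l) :=
  fun _ _ _ hS => hS.reaches h

theorem leads_block (φ : Fin 3) : ∃ δ G, Leads φ (blocks 1) (φ + 1) δ G ∧ δ.1 = δ.2 := by
  have h : ∀ φ : Fin 3, (steady φ).Reaches (blocks 1) (if φ = 2 then (2, 2) else 0)
    (steady (φ + 1)) := by decide +kernel
  exact ⟨_, _, leads_of_reaches (h φ), by split_ifs <;> rfl⟩

theorem leads_blocks (φ : Fin 3) (n : ℕ) :
    ∃ δ G, Leads φ (blocks n) (φ + Fin.ofNat 3 n) δ G ∧ δ.1 = δ.2 := by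
  induction n with
  | zero =>
    refine ⟨0, [], fun O σ S hS => ⟨?_, rfl⟩, rfl⟩
    simpa [place, blocks, Cfg.run] using hS
  | succ n ih =>
    obtain ⟨δ, G, h, e⟩ := ih
    obtain ⟨δ', G', h', e'⟩ := leads_block (φ + Fin.ofNat 3 n)
    refine ⟨δ + δ', G ++ G'.map (· + δ), ?_, by simp [e, e']⟩
    rw [blocks_add, show φ + Fin.ofNat 3 (n + 1) = φ + Fin.ofNat 3 n + 1 by
      ext; simp [Fin.val_add, add_assoc]]
    exact h.trans h'

/-- Three blocks dig one step of the diagonal tunnel. -/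
theorem leads_cycle : Leads 0 (blocks 3) 0 (2, 2) ((steady 0).output (blocks 3)) :=
  leads_of_reaches (by decide +kernel)

theorem length_output_cycle : ((steady 0).output (blocks 3)).length = 6 := by decide +kernel

/-- An additional `H` disturbs the tunnel only for a while: about twenty blocks later the particle is
back in a steady configuration, heading in the same direction. It has moved off the diagonal by
one cell, whence the asymmetry of `δ`. -/
theorem leads_extra (φ : Fin 3) : ∃ T ≤ 21, φ + Fin.ofNat 3 T = 2 ∧ ∃ δ G,
    Leads φ (false :: blocks T) 0 δ G ∧ δ.2 = δ.1 + 2 ∧ 0 < G.length := by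
  have h : ∀ φ : Fin 3, ∃ T ∈ [19, 20, 21], ∃ δ ∈ [((8, 10) : ℤ × ℤ), (10, 12)],
      φ + Fin.ofNat 3 T = 2 ∧ (steady φ).Reaches (false :: blocks T) δ (steady 0) ∧
      δ.2 = δ.1 + 2 ∧ 0 < ((steady φ).output (false :: blocks T)).length := by decide +kernel
  obtain ⟨T, hT, δ, -, h1, h2, h3, h4⟩ := h φ
  refine ⟨T, ?_, h1, δ, _, leads_of_reaches h2, h3, h4⟩
  simp only [List.mem_cons, List.not_mem_nil, or_false] at hT
  omega

/-- The word `H(HHHV)^q`, a period of the cutting sequence of slope `3 + 1 / q`. -/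
def word (q : ℕ) : List Bool := false :: blocks q

theorem length_word (q : ℕ) : (word q).length = 4 * q + 1 := by
  simp [word, length_blocks]

theorem leads_word {q : ℕ} (hq : 21 ≤ q) (φ : Fin 3) : ∃ δ G,
    Leads φ (word q) (φ + Fin.ofNat 3 (q + 1)) δ G ∧ δ.2 = δ.1 + 2 ∧ 0 < G.length := by
  obtain ⟨T, hT, hφ, δ, G, h, e, hG⟩ := leads_extra φ
  obtain ⟨δ', G', h', e'⟩ := leads_blocks 0 (q - T)
  refine ⟨δ + δ', G ++ G'.map (· + δ), ?_, ?_, ?_⟩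
  · have hw : word q = (false :: blocks T) ++ blocks (q - T) := by
      rw [word, List.cons_append, ← blocks_add]; congr 2; omega
    have hp : φ + Fin.ofNat 3 (q + 1) = 0 + Fin.ofNat 3 (q - T) := by
      have := congrArg Fin.val hφ
      ext
      simp only [Fin.val_add, Fin.ofNat] at this ⊢
      have := φ.2
      change (φ.val + T % 3) % 3 = 2 at *
      simp
      omega
    rw [hw, hp]
    exact h.trans h'
  · simp only [Prod.fst_add, Prod.snd_add]; omega
  · simp; omega

/-- A word shifts the phase `φ` of the steady configuration by `q + 1` modulo three, so three words
restore it. -/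
theorem leads_three_words {q : ℕ} (hq : 21 ≤ q) (φ : Fin 3) : ∃ δ G,
    Leads φ (word q ++ word q ++ word q) φ δ G ∧ δ.2 = δ.1 + 6 ∧ 0 < G.length := by
  obtain ⟨δ₁, G₁, h₁, e₁, l₁⟩ := leads_word hq φ
  obtain ⟨δ₂, G₂, h₂, e₂, l₂⟩ := leads_word hq (φ + Fin.ofNat 3 (q + 1))
  obtain ⟨δ₃, G₃, h₃, e₃, l₃⟩ := leads_word hq (φ + Fin.ofNat 3 (q + 1) + Fin.ofNat 3 (q + 1))
  have hp : φ + Fin.ofNat 3 (q + 1) + Fin.ofNat 3 (q + 1) + Fin.ofNat 3 (q + 1) = φ := by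
    have : ∀ φ x : Fin 3, φ + x + x + x = φ := by decide
    exact this _ _
  rw [hp] at h₃
  refine ⟨_, _, (h₁.trans h₂).trans h₃, ?_, ?_⟩
  · simp only [Prod.fst_add, Prod.snd_add]; omega
  · simp; omega

/-- The initial configuration: the particle is in the unit square and all walls are solid. -/
def start : Cfg := ⟨(1, 1), (1, 1), ∅⟩

/-- At most fourteen blocks after the first vertical line the particle is in a steady configuration. -/
theorem models_start (a : ℕ) (ha : a < 4) : ∃ t ≤ 14, ∃ O σ,
    Models O σ (start.run (List.replicate a false ++ true :: blocks t)) (steady 0) := by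
  -- the starting cell is put at `(20, 20)`, so that the window contains all that is consulted
  have key : ∀ σ : ℤ × ℤ, σ.1 * σ.1 = 1 → σ.2 * σ.2 = 1 → ∀ l δ,
      FinCfg.Reaches ⟨(20, 20), σ, []⟩ l δ (steady 0) →
      ∃ O σ, Models O σ (start.run l) (steady 0) := by
    intro σ h₁ h₂ l δ hr
    have h : Models (1 - σ.1 * 20, 1 - σ.2 * 20) σ start ⟨(20, 20), σ, []⟩ := by
      refine ⟨?_, ?_, by simp [start, place], by simp [start, h₁, h₂], by simp [start]⟩
      · rintro h; simp [h] at h₁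
      · rintro h; simp [h] at h₂
    exact ⟨_, _, (h.reaches hr).1⟩
  obtain rfl | rfl | rfl | rfl : a = 0 ∨ a = 1 ∨ a = 2 ∨ a = 3 := by omega
  · exact ⟨10, by norm_num, key (-1, 1) rfl rfl _ (26, 28) (by decide +kernel)⟩
  · exact ⟨14, by norm_num, key (1, -1) rfl rfl _ (28, 28) (by decide +kernel)⟩
  · exact ⟨12, by norm_num, key (1, 1) rfl rfl _ (28, 28) (by decide +kernel)⟩
  · exact ⟨9, by norm_num, key (1, 1) rfl rfl _ (26, 28) (by decide +kernel)⟩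

/-! ### Infinite words -/

/-- The configuration after the first `n` letters of `c`. -/
noncomputable def orbit (c : ℕ → Bool) : ℕ → Cfg
  | 0 => start
  | n + 1 => (orbit c n).step (c n)

/-- A collision happens at the letter `n`. -/
def HitAt (c : ℕ → Bool) (n : ℕ) : Prop := (orbit c n).front (c n) ∉ (orbit c n).erased

open Classical in
/-- The number of collisions at the first `n` letters. -/
noncomputable def hitCount (c : ℕ → Bool) (n : ℕ) : ℕ := Nat.count (HitAt c) n

/-- The letter at which the `i`-th collision happens. -/
noncomputable def hitTime (c : ℕ → Bool) (i : ℕ) : ℕ := Nat.nth (HitAt c) i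

/-- The midpoint of the wall of the `i`-th collision, in coordinates scaled by two. -/
noncomputable def hitPoint (c : ℕ → Bool) (i : ℕ) : ℤ × ℤ :=
  (orbit c (hitTime c i)).front (c (hitTime c i))

/-- The sequence `c` has the word given as last argument at position `n`. -/
def Reads (c : ℕ → Bool) : ℕ → List Bool → Prop
  | _, [] => True
  | n, b :: l => c n = b ∧ Reads c (n + 1) l

theorem reads_append {c : ℕ → Bool} {n : ℕ} {l l' : List Bool} :
    Reads c n (l ++ l') ↔ Reads c n l ∧ Reads c (n + l.length) l' := by
  induction l generalizing n with
  | nil => simp [Reads]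
  | cons b l ih => simp [Reads, ih, and_assoc, add_assoc, add_comm 1]

theorem Reads.orbit_add {c : ℕ → Bool} {n : ℕ} {l : List Bool} (h : Reads c n l) :
    orbit c (n + l.length) = (orbit c n).run l := by
  induction l generalizing n with
  | nil => rfl
  | cons b l ih =>
    obtain ⟨rfl, h⟩ := h
    rw [Cfg.run, ← orbit, ← ih h, List.length_cons]
    congr 1; omega

theorem Reads.hitCount_add {c : ℕ → Bool} {n : ℕ} {l : List Bool} (h : Reads c n l) :
    hitCount c (n + l.length) = hitCount c n + ((orbit c n).hits l).length := by
  induction l generalizing n with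
  | nil => rfl
  | cons b l ih =>
    obtain ⟨rfl, h⟩ := h
    have := ih h
    rw [List.length_cons, show n + (l.length + 1) = n + 1 + l.length by omega, this, Cfg.hits,
      hitCount, Nat.count_succ, ← hitCount, orbit]
    by_cases hh : HitAt c n
    · rw [if_pos hh, if_neg hh, List.length_cons]; omega
    · rw [if_neg hh, if_pos (not_not.1 hh), add_zero]

open Classical in
theorem Reads.hitPoint_add {c : ℕ → Bool} {n : ℕ} {l : List Bool} (h : Reads c n l) (j : ℕ)
    (hj : j < ((orbit c n).hits l).length) :
    hitPoint c (hitCount c n + j) = ((orbit c n).hits l)[j] := by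
  induction l generalizing n j with
  | nil => simp [Cfg.hits] at hj
  | cons b l ih =>
    obtain ⟨rfl, h⟩ := h
    have hc : hitCount c (n + 1) = hitCount c n + if HitAt c n then 1 else 0 := Nat.count_succ ..
    simp only [Cfg.hits] at hj ⊢
    by_cases hh : HitAt c n
    · simp only [if_neg (show ¬ _ from hh)] at hj ⊢
      rw [if_pos hh] at hc
      cases j with
      | zero =>
        have : hitTime c (hitCount c n) = n := Nat.nth_count hh
        simp [hitPoint, this]
      | succ j =>
        have := ih h j (Nat.lt_of_succ_lt_succ hj)
        rw [hc] at this
        simp only [List.getElem_cons_succ]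
        rw [show hitCount c n + (j + 1) = hitCount c n + 1 + j by omega, this]
        rfl
    · simp only [if_pos (not_not.1 hh)] at hj ⊢
      rw [if_neg hh, add_zero] at hc
      have := ih h j hj
      rw [hc] at this
      exact this

theorem orbit_odd (c : ℕ → Bool) (n : ℕ) :
    (Odd (orbit c n).pos.1 ∧ Odd (orbit c n).pos.2) ∧
      ((orbit c n).dir.1 = 1 ∨ (orbit c n).dir.1 = -1) ∧
      ((orbit c n).dir.2 = 1 ∨ (orbit c n).dir.2 = -1) := by
  induction n with
  | zero => simp [orbit, start]
  | succ n ih =>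
    obtain ⟨⟨h1, h2⟩, h3, h4⟩ := ih
    rw [orbit, Cfg.step]
    have h5 : ∀ x y : ℤ, Odd x → Odd (x + 2 * y) := fun x y h => h.add_even (even_two_mul y)
    split_ifs
    · cases c n
      · exact ⟨⟨h1, h5 _ _ h2⟩, h3, h4⟩
      · exact ⟨⟨h5 _ _ h1, h2⟩, h3, h4⟩
    · cases c n <;> refine ⟨⟨h1, h2⟩, ?_⟩ <;> simp only [flipDir, cond_true, cond_false] <;> omega

/-- From the collision `n₀` on, the walls hit are periodic with period `k₀` up to the translation
`D`, and no smaller shift `k ≤ r` has a constant displacement in the long run. -/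
structure Digs (c : ℕ → Bool) (D : ℤ × ℤ) (k₀ n₀ : ℕ) (r : ℕ) : Prop where
  period_pos : 0 < k₀
  ne_zero : D ≠ 0
  even : Even D.1 ∧ Even D.2
  infinite : {n | HitAt c n}.Infinite
  periodic : ∀ n, n₀ ≤ n → hitPoint c (n + k₀) = hitPoint c n + D
  straight : ∀ d : ℤ × ℤ, ∀ k, k ≤ r → (∀ᶠ n in Filter.atTop, hitPoint c (n + k) = hitPoint c n + d)
    → k = 0

theorem add_mul_of_add {f : ℕ → ℤ × ℤ} {k n₀ : ℕ} {d : ℤ × ℤ}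
    (h : ∀ n, n₀ ≤ n → f (n + k) = f n + d) {n : ℕ} (hn : n₀ ≤ n) (m : ℕ) :
    f (n + k * m) = f n + m • d := by
  induction m with
  | zero => simp
  | succ m ih =>
    rw [mul_add, mul_one, ← add_assoc, h _ (by omega), ih, succ_nsmul, add_assoc]

/-- The lower bound for the shifts `k`: far out there is a straight part of the tunnel which contains
the collisions `n` and `n + 6 * k`, so that six displacements by `k` are `k` steps along the
diagonal. The displacement `D` of three words would then be diagonal too, which it is not. -/
theorem digs_of_reads {c : ℕ → Bool} {a j q : ℕ} (ha : a < 4) (hj : 14 ≤ j) (hq : 24 ≤ q)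
    (h0 : Reads c 0 (List.replicate a false ++ true :: blocks j))
    (h : ∀ m, Reads c (a + 1 + 4 * j + (4 * q + 1) * m) (word q)) :
    ∃ D k₀ n₀, Digs c D k₀ n₀ ((q - 24) / 3) := by
  obtain ⟨t, ht, O, σ, hO⟩ := models_start a ha
  obtain ⟨δ₀, G₀, hl₀, -⟩ := leads_blocks 0 (j - t)
  generalize (0 : Fin 3) + Fin.ofNat 3 (j - t) = φ at hl₀
  obtain ⟨δ, G, hl, hδ, hG⟩ := leads_three_words (q := q) (by omega) φ
  set O₀ := place O σ δ₀
  -- the state at the beginning of every third word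
  have hb : Models O₀ σ (orbit c (a + 1 + 4 * j)) (steady φ) := by
    have e := h0.orbit_add
    have hj' : blocks j = blocks t ++ blocks (j - t) := by rw [← blocks_add]; congr 1; omega
    rw [hj', ← List.cons_append, ← List.append_assoc, Cfg.run_append] at e
    have := (hl₀ _ _ _ hO).1
    rw [← show orbit c 0 = start from rfl, ← e] at this
    convert this using 2
    simp [length_blocks]
    omega
  have hr3 : ∀ m, Reads c (a + 1 + 4 * j + (4 * q + 1) * (3 * m)) (word q ++ word q ++ word q) := by
    intro m
    rw [reads_append, reads_append]
    refine ⟨⟨h _, ?_⟩, ?_⟩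
    · convert h (3 * m + 1) using 1
      rw [length_word]; ring
    · convert h (3 * m + 2) using 1
      rw [List.length_append, length_word]; ring
  have hadd : ∀ m : ℕ, a + 1 + 4 * j + (4 * q + 1) * (3 * (m + 1)) =
      a + 1 + 4 * j + (4 * q + 1) * (3 * m) + (word q ++ word q ++ word q).length := by
    intro m
    simp only [List.length_append, length_word]; ring
  have hM : ∀ m : ℕ, Models (place O₀ σ (m • δ)) σ
      (orbit c (a + 1 + 4 * j + (4 * q + 1) * (3 * m))) (steady φ) := by
    intro m
    induction m with
    | zero => simpa [place] using hb
    | succ m ih =>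
      rw [hadd, (hr3 m).orbit_add]
      have := (hl _ _ _ ih).1
      rwa [place_place, ← succ_nsmul'] at this
  have hhits := fun m => (hl _ _ _ (hM m)).2
  have hcount : ∀ m : ℕ, hitCount c (a + 1 + 4 * j + (4 * q + 1) * (3 * m)) =
      hitCount c (a + 1 + 4 * j) + G.length * m := by
    intro m
    induction m with
    | zero => simp
    | succ m ih =>
      rw [hadd, (hr3 m).hitCount_add, ih, hhits, List.length_map]; ring
  have hper : ∀ n, hitCount c (a + 1 + 4 * j) ≤ n → hitPoint c (n + G.length) =
      hitPoint c n + (σ.1 * δ.1, σ.2 * δ.2) := by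
    intro n hn
    have hpt : ∀ m i : ℕ, ∀ hi : i < G.length, hitPoint c (hitCount c (a + 1 + 4 * j) +
        G.length * m + i) = place (place O₀ σ (m • δ)) σ G[i] := by
      intro m i hi
      have hi' : i < ((orbit c (a + 1 + 4 * j + (4 * q + 1) * (3 * m))).hits
        (word q ++ word q ++ word q)).length := by rw [hhits, List.length_map]; exact hi
      have := (hr3 m).hitPoint_add i hi'
      rw [hcount] at this
      rw [this]
      simp only [hhits, List.getElem_map]
    have e : n = hitCount c (a + 1 + 4 * j) + G.length * ((n - hitCount c (a + 1 + 4 * j)) /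
        G.length) + (n - hitCount c (a + 1 + 4 * j)) % G.length := by
      have := Nat.div_add_mod (n - hitCount c (a + 1 + 4 * j)) G.length
      omega
    have hi := Nat.mod_lt (n - hitCount c (a + 1 + 4 * j)) hG
    generalize (n - hitCount c (a + 1 + 4 * j)) % G.length = i at *
    generalize (n - hitCount c (a + 1 + 4 * j)) / G.length = m at *
    have e' : n + G.length = hitCount c (a + 1 + 4 * j) + G.length * (m + 1) + i := by
      rw [e]; ring
    rw [e', e, hpt _ _ hi, hpt _ _ hi]
    simp only [place, succ_nsmul, Prod.fst_add, Prod.snd_add, Prod.mk_add_mk, Prod.mk.injEq]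
    constructor <;> ring
  have hσ₁ := hb.ne₁
  have hσ₂ := hb.ne₂
  refine ⟨(σ.1 * δ.1, σ.2 * δ.2), G.length, _, hG, ?_, ?_, ?_, hper, ?_⟩
  · intro h0
    simp only [Prod.mk_eq_zero, mul_eq_zero, hσ₁, hσ₂, false_or] at h0
    omega
  · have h1 := (orbit_odd c (a + 1 + 4 * j)).1
    have h2 := (orbit_odd c (a + 1 + 4 * j + (4 * q + 1) * (3 * 1))).1
    have e1 := (hM 1).pos
    rw [hb.pos] at h1
    rw [e1] at h2
    have h3 := h2.1.sub_odd h1.1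
    have h4 := h2.2.sub_odd h1.2
    simp only [place, one_nsmul] at h3 h4
    ring_nf at h3 h4
    exact ⟨h3, h4⟩
  · intro hfin
    classical
    have h1 := Nat.count_le_card hfin
      (a + 1 + 4 * j + (4 * q + 1) * (3 * (hfin.toFinset.card + 1)))
    have h2 := hcount (hfin.toFinset.card + 1)
    have h3 := Nat.le_mul_of_pos_left (hfin.toFinset.card + 1) hG
    have h4 : hitCount c (a + 1 + 4 * j + (4 * q + 1) * (3 * (hfin.toFinset.card + 1))) ≤
        hfin.toFinset.card := by
      rw [hitCount]; convert h1
    omega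
  · intro d k hk hev
    obtain ⟨N₁, hN₁⟩ := Filter.eventually_atTop.1 hev
    obtain ⟨T, hT, -, δ₁, G₁, hl₁, -, -⟩ := leads_extra φ
    -- a word whose straight part lies beyond the collision number `N₁`
    have hrw := h (3 * N₁)
    rw [show word q = (false :: blocks T) ++ blocks (q - T) by
      rw [word, List.cons_append, ← blocks_add]; congr 2; omega, reads_append] at hrw
    obtain ⟨hr₁, hr₂⟩ := hrw
    have hM₁ := (hl₁ _ _ _ (hM N₁)).1
    rw [← hr₁.orbit_add] at hM₁
    have hc₁ := hr₁.hitCount_add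
    rw [hcount] at hc₁
    generalize a + 1 + 4 * j + (4 * q + 1) * (3 * N₁) + (false :: blocks T).length = n at *
    generalize place (place O₀ σ (N₁ • δ)) σ δ₁ = O₁ at *
    have hreads : ∀ s : ℕ, 3 * (s + 1) ≤ q - T → Reads c (n + 12 * s) (blocks 3) := by
      intro s hs
      have e : blocks (q - T) = blocks (3 * s) ++ (blocks 3 ++ blocks (q - T - 3 * (s + 1))) := by
        rw [← blocks_add, ← blocks_add]; congr 1; omega
      rw [e, reads_append, reads_append, length_blocks] at hr₂
      convert hr₂.2.1 using 1
      omega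
    have hs : ∀ s : ℕ, 3 * s ≤ q - T → Models (place O₁ σ (s • (2, 2))) σ (orbit c (n + 12 * s))
        (steady 0) ∧ hitCount c (n + 12 * s) = hitCount c n + 6 * s := by
      intro s hs
      induction s with
      | zero => exact ⟨by simpa [place] using hM₁, rfl⟩
      | succ s ih =>
        obtain ⟨ih1, ih2⟩ := ih (by omega)
        obtain ⟨h1, h2⟩ := leads_cycle _ _ _ ih1
        rw [show n + 12 * (s + 1) = n + 12 * s + (blocks 3).length by rw [length_blocks]; ring,
          (hreads s hs).orbit_add, (hreads s hs).hitCount_add, ih2, h2, List.length_map,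
          length_output_cycle]
        rw [place_place, ← succ_nsmul'] at h1
        exact ⟨h1, by ring⟩
    have hpt : ∀ s : ℕ, 3 * (s + 1) ≤ q - T → hitPoint c (hitCount c n + 6 * s) =
        place (place O₁ σ (s • (2, 2))) σ (((steady 0).output (blocks 3))[0]'
          (by rw [length_output_cycle]; norm_num)) := by
      intro s hs'
      obtain ⟨h1, h2⟩ := hs s (by omega)
      have h3 := (leads_cycle _ _ _ h1).2
      have hi' : 0 < ((orbit c (n + 12 * s)).hits (blocks 3)).length := by
        rw [h3, List.length_map, length_output_cycle]; norm_num
      have := (hreads s hs').hitPoint_add 0 hi'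
      rw [h2, add_zero] at this
      rw [this]
      simp only [h3, List.getElem_map]
    have hn : N₁ ≤ hitCount c n := by
      rw [hc₁]
      have := Nat.le_mul_of_pos_left N₁ hG
      omega
    have hn' : hitCount c (a + 1 + 4 * j) ≤ hitCount c n := by omega
    have e1 := add_mul_of_add hN₁ hn 6
    rw [mul_comm, hpt k (by omega)] at e1
    have e0 := hpt 0 (by omega)
    rw [mul_zero, add_zero] at e0
    rw [e0] at e1
    have e2 := add_mul_of_add hN₁ hn G.length
    rw [mul_comm, add_mul_of_add hper hn' k] at e2
    simp only [place, Prod.smul_mk, nsmul_eq_mul, Nat.cast_ofNat, mul_zero, Nat.cast_zero, zero_mul,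
      add_zero, Prod.ext_iff, Prod.fst_add, Prod.snd_add, Prod.fst_mul, Prod.snd_mul,
      Prod.fst_natCast, Prod.snd_natCast, Prod.fst_ofNat, Prod.snd_ofNat] at e1 e2
    by_contra hk0
    have hk0' : (k : ℤ) ≠ 0 := by exact_mod_cast hk0
    have f1 : (G.length : ℤ) = 3 * δ.1 := by
      have : (2 * k * σ.1 : ℤ) * (G.length - 3 * δ.1) = 0 := by
        linear_combination (G.length : ℤ) * e1.1 - 6 * e2.1
      have := (mul_eq_zero.1 this).resolve_left (by positivity)
      omega
    have f2 : (G.length : ℤ) = 3 * δ.2 := by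
      have : (2 * k * σ.2 : ℤ) * (G.length - 3 * δ.2) = 0 := by
        linear_combination (G.length : ℤ) * e1.2 - 6 * e2.2
      have := (mul_eq_zero.1 this).resolve_left (by positivity)
      omega
    omega

/-! ### The cutting sequence of a half-line -/

/-- The line through `(x, y)` of slope `s` contains no vertex of the grid, and `(x, y)` lies in the
open unit square. -/
structure IsGeneric (x y s : ℝ) : Prop where
  x_pos : 0 < x
  x_lt : x < 1
  y_pos : 0 < y
  y_lt : y < 1
  s_pos : 0 < s
  avoids : ∀ i j : ℤ, y + s * (i - x) ≠ j

open Classical in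
/-- The numbers of the vertical and of the horizontal grid lines among the first `n` that the
half-line crosses. The next line is vertical if and only if the half-line meets the vertical line
`(crossed x y s n).1 + 1` below the height `(crossed x y s n).2 + 1`. -/
noncomputable def crossed (x y s : ℝ) : ℕ → ℕ × ℕ
  | 0 => (0, 0)
  | n + 1 => if y + s * ((crossed x y s n).1 + 1 - x) < (crossed x y s n).2 + 1 then
      ((crossed x y s n).1 + 1, (crossed x y s n).2)
    else ((crossed x y s n).1, (crossed x y s n).2 + 1)

open Classical in
/-- The cutting sequence, with `true` for the vertical lines. -/
noncomputable def cutting (x y s : ℝ) (n : ℕ) : Bool :=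
  decide (y + s * ((crossed x y s n).1 + 1 - x) < (crossed x y s n).2 + 1)

/-- The time, that is, the horizontal distance from `(x, y)`, of the crossing `n`. -/
noncomputable def crossTime (x y s : ℝ) (n : ℕ) : ℝ :=
  bif cutting x y s n then (crossed x y s n).1 + 1 - x else ((crossed x y s n).2 + 1 - y) / s

/-- The time from which on exactly `n` lines have been crossed. -/
noncomputable def stageStart (x y s : ℝ) : ℕ → ℝ
  | 0 => 0
  | n + 1 => crossTime x y s n

section
variable {x y s : ℝ}

theorem cutting_eq_true {n : ℕ} : cutting x y s n = true ↔
    y + s * ((crossed x y s n).1 + 1 - x) < (crossed x y s n).2 + 1 := by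
  simp [cutting]

theorem crossed_succ (n : ℕ) : crossed x y s (n + 1) = bif cutting x y s n then
    ((crossed x y s n).1 + 1, (crossed x y s n).2)
    else ((crossed x y s n).1, (crossed x y s n).2 + 1) := by
  rw [crossed]
  split_ifs with h
  · rw [cutting_eq_true.2 h]; rfl
  · rw [Bool.eq_false_iff.2 (mt cutting_eq_true.1 h)]; rfl

theorem crossed_add (n : ℕ) : (crossed x y s n).1 + (crossed x y s n).2 = n := by
  induction n with
  | zero => rfl
  | succ n ih =>
    rw [crossed_succ]
    cases cutting x y s n <;> simp <;> omega

theorem IsGeneric.lt_of_not_cutting (hg : IsGeneric x y s) {n : ℕ} (h : cutting x y s n = false) :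
    ((crossed x y s n).2 + 1 : ℝ) < y + s * ((crossed x y s n).1 + 1 - x) := by
  have h1 : ¬ _ := fun h' => by rw [cutting_eq_true.2 h'] at h; cases h
  refine lt_of_le_of_ne (not_lt.1 h1) fun h2 => ?_
  refine hg.avoids ((crossed x y s n).1 + 1) ((crossed x y s n).2 + 1) ?_
  push_cast
  exact h2.symm

theorem IsGeneric.bounds (hg : IsGeneric x y s) (n : ℕ) :
    ((crossed x y s n).2 : ℝ) < y + s * ((crossed x y s n).1 + 1 - x) ∧
      y + s * ((crossed x y s n).1 - x) < (crossed x y s n).2 + 1 := by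
  obtain ⟨hx, hx', hy, hy', hs, -⟩ := id hg
  induction n with
  | zero =>
    simp only [crossed, Nat.cast_zero]
    constructor <;> nlinarith
  | succ n ih =>
    rw [crossed_succ]
    cases h : cutting x y s n
    · have := hg.lt_of_not_cutting h
      simp only [cond_false]
      push_cast
      exact ⟨this, by linarith [ih.2]⟩
    · have := cutting_eq_true.1 h
      simp only [cond_true]
      push_cast
      exact ⟨by nlinarith [ih.1], this⟩

theorem crossTime_of_true {n : ℕ} (h : cutting x y s n = true) :
    crossTime x y s n = (crossed x y s n).1 + 1 - x := by rw [crossTime, h]; rfl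

theorem IsGeneric.mul_crossTime (hg : IsGeneric x y s) {n : ℕ} (h : cutting x y s n = false) :
    y + s * crossTime x y s n = (crossed x y s n).2 + 1 := by
  rw [crossTime, h, cond_false, mul_div_cancel₀ _ hg.s_pos.ne']; ring

theorem IsGeneric.crossTime_le (hg : IsGeneric x y s) (n : ℕ) :
    x + crossTime x y s n ≤ (crossed x y s n).1 + 1 ∧
      y + s * crossTime x y s n ≤ (crossed x y s n).2 + 1 := by
  cases h : cutting x y s n
  · have h1 := hg.mul_crossTime h
    have h2 := hg.lt_of_not_cutting h
    refine ⟨?_, h1.le⟩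
    by_contra! h3
    nlinarith [hg.s_pos]
  · have h1 := crossTime_of_true h
    have h2 := cutting_eq_true.1 h
    rw [h1]
    exact ⟨by linarith, h2.le⟩

theorem IsGeneric.le_stageStart (hg : IsGeneric x y s) (n : ℕ) :
    (crossed x y s n).1 ≤ x + stageStart x y s n ∧
      (crossed x y s n).2 ≤ y + s * stageStart x y s n := by
  cases n with
  | zero => simp [crossed, stageStart, hg.x_pos.le, hg.y_pos.le]
  | succ n =>
    rw [stageStart, crossed_succ]
    have hb := hg.bounds n
    cases h : cutting x y s n
    · have h1 := hg.mul_crossTime h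
      simp only [cond_false]
      push_cast
      refine ⟨?_, h1.ge⟩
      by_contra! h3
      nlinarith [hg.s_pos]
    · have h1 := crossTime_of_true h
      simp only [cond_true]
      rw [h1]
      push_cast
      exact ⟨by linarith, hb.1.le⟩

theorem IsGeneric.stageStart_lt (hg : IsGeneric x y s) (n : ℕ) :
    stageStart x y s n < crossTime x y s n := by
  have hs := hg.s_pos
  cases n with
  | zero =>
    rw [stageStart]
    cases h : cutting x y s 0
    · have h1 := hg.mul_crossTime h
      simp only [crossed, Nat.cast_zero] at h1
      by_contra! h3
      nlinarith [hg.y_lt]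
    · rw [crossTime_of_true h]
      simp [crossed, hg.x_lt]
  | succ n =>
    rw [stageStart]
    cases h : cutting x y s n <;> cases h' : cutting x y s (n + 1)
    · have h1 := hg.mul_crossTime h
      have h2 := hg.mul_crossTime h'
      rw [crossed_succ, h] at h2
      simp only [cond_false] at h2
      push_cast at h2
      by_contra! h3
      nlinarith
    · have h1 := hg.mul_crossTime h
      have h2 := hg.lt_of_not_cutting h
      rw [crossTime_of_true h', crossed_succ, h, cond_false]
      by_contra! h3
      nlinarith
    · have h1 := hg.mul_crossTime h'
      have h2 := cutting_eq_true.1 h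
      rw [crossTime_of_true h]
      rw [crossed_succ, h, cond_true] at h1
      by_contra! h3
      simp only at h1
      nlinarith
    · rw [crossTime_of_true h, crossTime_of_true h', crossed_succ, h, cond_true]
      push_cast
      linarith

theorem IsGeneric.strictMono (hg : IsGeneric x y s) : StrictMono (stageStart x y s) :=
  strictMono_nat_of_lt_succ hg.stageStart_lt

theorem IsGeneric.mem_cell (hg : IsGeneric x y s) {n : ℕ} {t : ℝ} (h1 : stageStart x y s n < t)
    (h2 : t < crossTime x y s n) :
    ((crossed x y s n).1 < x + t ∧ x + t < (crossed x y s n).1 + 1) ∧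
      ((crossed x y s n).2 < y + s * t ∧ y + s * t < (crossed x y s n).2 + 1) := by
  have h3 := hg.le_stageStart n
  have h4 := hg.crossTime_le n
  have h5 := mul_lt_mul_of_pos_left h1 hg.s_pos
  have h6 := mul_lt_mul_of_pos_left h2 hg.s_pos
  refine ⟨⟨?_, ?_⟩, ?_, ?_⟩ <;> linarith

theorem IsGeneric.exists_crossed_fst (hg : IsGeneric x y s) (i : ℕ) :
    ∃ n, (crossed x y s n).1 = i ∧ cutting x y s n = true := by
  have hex : ∃ n, i < (crossed x y s n).1 := by
    by_contra! h
    obtain ⟨n, hn⟩ := exists_nat_gt (y + s * (i + 1 - x) + i)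
    have h1 := (hg.bounds n).1
    have h2 : ((crossed x y s n).1 : ℝ) ≤ i := by exact_mod_cast h n
    have h3 : ((crossed x y s n).1 : ℝ) + (crossed x y s n).2 = n := by
      exact_mod_cast crossed_add n
    have := mul_le_mul_of_nonneg_left h2 hg.s_pos.le
    nlinarith
  classical
  have h1 := Nat.find_spec hex
  have h2 := fun m => Nat.find_min hex (m := m)
  generalize Nat.find hex = n at h1 h2
  cases n with
  | zero => simp [crossed] at h1
  | succ n =>
    have h3 := h2 n (by omega)
    rw [crossed_succ] at h1
    refine ⟨n, ?_⟩
    cases h : cutting x y s n <;> rw [h] at h1 <;> simp at h1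
    · omega
    · exact ⟨by omega, rfl⟩

theorem IsGeneric.exists_crossed_snd (hg : IsGeneric x y s) (i : ℕ) :
    ∃ n, (crossed x y s n).2 = i ∧ cutting x y s n = false := by
  have hex : ∃ n, i < (crossed x y s n).2 := by
    by_contra! h
    obtain ⟨n, hn⟩ := exists_nat_gt (((i : ℝ) + 1) / s + x + i)
    have h1 := (hg.bounds n).2
    have h2 : ((crossed x y s n).2 : ℝ) ≤ i := by exact_mod_cast h n
    have h3 : ((crossed x y s n).1 : ℝ) + (crossed x y s n).2 = n := by
      exact_mod_cast crossed_add n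
    have h4 : ((i : ℝ) + 1) / s < (crossed x y s n).1 - x := by linarith
    rw [div_lt_iff₀ hg.s_pos] at h4
    linarith [hg.y_pos]
  classical
  have h1 := Nat.find_spec hex
  have h2 := fun m => Nat.find_min hex (m := m)
  generalize Nat.find hex = n at h1 h2
  cases n with
  | zero => simp [crossed] at h1
  | succ n =>
    have h3 := h2 n (by omega)
    rw [crossed_succ] at h1
    refine ⟨n, ?_⟩
    cases h : cutting x y s n <;> rw [h] at h1 <;> simp at h1
    · exact ⟨by omega, rfl⟩
    · omega

theorem IsGeneric.not_both (hg : IsGeneric x y s) {t : ℝ} (h1 : IsInt (x + t))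
    (h2 : IsInt (y + s * t)) : False := by
  obtain ⟨i, hi⟩ := h1
  obtain ⟨j, hj⟩ := h2
  refine hg.avoids i j ?_
  rw [← hi, ← hj]; ring

theorem IsGeneric.crossTime_types (hg : IsGeneric x y s) (n : ℕ) :
    (cutting x y s n = true ↔ IsInt (x + crossTime x y s n)) ∧
      (cutting x y s n = false ↔ IsInt (y + s * crossTime x y s n)) := by
  cases h : cutting x y s n
  · have h1 : IsInt (y + s * crossTime x y s n) :=
      ⟨(crossed x y s n).2 + 1, by rw [hg.mul_crossTime h]; push_cast; rfl⟩
    exact ⟨⟨fun h => by simp at h, fun h => (hg.not_both h h1).elim⟩, ⟨fun _ => h1, fun _ => rfl⟩⟩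
  · have h1 : IsInt (x + crossTime x y s n) :=
      ⟨(crossed x y s n).1 + 1, by rw [crossTime_of_true h]; push_cast; ring⟩
    exact ⟨⟨fun _ => h1, fun _ => rfl⟩, ⟨fun h => by simp at h, fun h => (hg.not_both h1 h).elim⟩⟩

end

/-- The type of wall that a letter stands for. -/
def letterType (b : Bool) : WallType := bif b then WallType.vertical else WallType.horizontal

theorem isCuttingSequence {P : Plane} {s : ℝ} (hg : IsGeneric (P 0) (P 1) s) :
    IsCuttingSequence P s fun n => letterType (cutting (P 0) (P 1) s n) := by
  refine ⟨crossTime (P 0) (P 1) s, strictMono_nat_of_lt_succ fun n => hg.stageStart_lt (n + 1),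
    ?_, fun n => ?_⟩
  · ext t
    simp only [Set.mem_range, Set.mem_ofPred_eq]
    constructor
    · rintro ⟨n, rfl⟩
      refine ⟨lt_of_le_of_lt (hg.strictMono.monotone (Nat.zero_le n)) (hg.stageStart_lt n), ?_⟩
      rw [mul_comm]
      have := hg.crossTime_types n
      cases h : cutting (P 0) (P 1) s n
      · exact Or.inr (this.2.1 h)
      · exact Or.inl (this.1.1 h)
    · rintro ⟨ht, ⟨z, hz⟩ | ⟨z, hz⟩⟩
      · have hz0 : 0 < z := by
          have := hg.x_pos
          have : (0 : ℝ) < z := by linarith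
          exact_mod_cast this
        obtain ⟨n, hn, hc⟩ := hg.exists_crossed_fst (z - 1).toNat
        refine ⟨n, ?_⟩
        have h2 : (((z - 1).toNat : ℤ) : ℝ) = z - 1 := by
          rw [Int.toNat_of_nonneg (by omega)]; push_cast; rfl
        rw [crossTime_of_true hc, hn]
        rw [Int.cast_natCast] at h2
        linarith
      · have hz0 : 0 < z := by
          have := hg.y_pos
          have := mul_pos ht hg.s_pos
          have : (0 : ℝ) < z := by linarith
          exact_mod_cast this
        obtain ⟨n, hn, hc⟩ := hg.exists_crossed_snd (z - 1).toNat
        refine ⟨n, ?_⟩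
        have h2 : (((z - 1).toNat : ℤ) : ℝ) = z - 1 := by
          rw [Int.toNat_of_nonneg (by omega)]; push_cast; rfl
        have h3 := hg.mul_crossTime hc
        rw [hn] at h3
        rw [Int.cast_natCast] at h2
        refine mul_left_cancel₀ hg.s_pos.ne' ?_
        linarith
  · rw [mul_comm _ s]
    have := hg.crossTime_types n
    rw [← this.1, ← this.2]
    cases h : cutting (P 0) (P 1) s n <;> simp [letterType, h]

/-! ### Slopes `3 + 1 / q` -/

section
variable {x y s : ℝ}

/-- The pair `crossed x y s n` is characterized by its sum and the inequalities of
`IsGeneric.bounds`. -/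
theorem crossed_unique (hg : IsGeneric x y s) {n v h : ℕ} (hn : v + h = n)
    (h1 : (h : ℝ) < y + s * (v + 1 - x)) (h2 : y + s * (v - x) < h + 1) :
    crossed x y s n = (v, h) := by
  have h3 := crossed_add (x := x) (y := y) (s := s) n
  obtain ⟨h4, h5⟩ := hg.bounds n
  have hs := hg.s_pos
  rcases lt_trichotomy (crossed x y s n).1 v with h6 | h6 | h6
  · have h7 : ((crossed x y s n).1 + 1 : ℝ) ≤ v := by exact_mod_cast h6
    have h8 : (h + 1 : ℝ) ≤ (crossed x y s n).2 := by
      exact_mod_cast (show h + 1 ≤ (crossed x y s n).2 by omega)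
    nlinarith
  · exact Prod.ext h6 (by simp only; omega)
  · have h7 : (v + 1 : ℝ) ≤ (crossed x y s n).1 := by exact_mod_cast h6
    have h8 : ((crossed x y s n).2 + 1 : ℝ) ≤ h := by
      exact_mod_cast (show (crossed x y s n).2 + 1 ≤ h by omega)
    nlinarith

theorem crossed_shift (hg : IsGeneric x y s) {q p : ℕ} (hq : (p : ℝ) = q * s) (n : ℕ) :
    crossed x y s (n + (q + p)) = ((crossed x y s n).1 + q, (crossed x y s n).2 + p) := by
  obtain ⟨h4, h5⟩ := hg.bounds n
  refine crossed_unique hg (by have := crossed_add (x := x) (y := y) (s := s) n; omega) ?_ ?_ <;>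
  · push_cast
    rw [hq]
    linarith

theorem cutting_periodic (hg : IsGeneric x y s) {q p : ℕ} (hq : (p : ℝ) = q * s) :
    Function.Periodic (cutting x y s) (q + p) := by
  intro n
  rw [Bool.eq_iff_iff, cutting_eq_true, cutting_eq_true, crossed_shift hg hq]
  push_cast
  rw [hq]
  constructor <;> intro h <;> linarith

theorem crossed_add_of_periodic {k : ℕ} (hk : Function.Periodic (cutting x y s) k) (n : ℕ) :
    (crossed x y s (n + k)).1 = (crossed x y s n).1 + (crossed x y s k).1 := by
  induction n with
  | zero => simp [crossed]
  | succ n ih =>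
    rw [show n + 1 + k = n + k + 1 by omega, crossed_succ, crossed_succ, hk n]
    cases cutting x y s n <;> simp [ih]
    omega

theorem crossed_mul_of_periodic {k : ℕ} (hk : Function.Periodic (cutting x y s) k) (m : ℕ) :
    (crossed x y s (m * k)).1 = m * (crossed x y s k).1 := by
  induction m with
  | zero => simp [crossed]
  | succ m ih => rw [add_mul, one_mul, crossed_add_of_periodic hk, ih]; ring

/-- Counting the vertical lines in the first `(q + p) * k` letters in two ways gives
`(q + p) * v = k * q`. -/
theorem dvd_of_periodic (hg : IsGeneric x y s) {q p k : ℕ} (hq : (p : ℝ) = q * s)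
    (hc : Nat.Coprime (q + p) q) (hk : Function.Periodic (cutting x y s) k) : q + p ∣ k := by
  have h1 := crossed_mul_of_periodic hk (q + p)
  rw [mul_comm (q + p) k, crossed_mul_of_periodic (cutting_periodic hg hq)] at h1
  have h2 : crossed x y s (q + p) = (q, p) := by
    have := crossed_shift hg hq 0
    simpa [crossed] using this
  rw [h2] at h1
  exact hc.dvd_of_dvd_mul_right ⟨_, h1⟩

theorem isLeastPeriod (hg : IsGeneric x y s) {q p : ℕ} (hq : (p : ℝ) = q * s) (h0 : 0 < q)
    (hc : Nat.Coprime (q + p) q) :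
    IsLeastPeriod (fun n => letterType (cutting x y s n)) (q + p) := by
  refine ⟨⟨by omega, fun n => by simp only [cutting_periodic hg hq n]⟩, ?_⟩
  rintro k ⟨hk0, hk⟩
  refine Nat.le_of_dvd hk0 (dvd_of_periodic hg hq hc fun n => ?_)
  have := hk n
  simp only at this
  revert this
  cases cutting x y s (n + k) <;> cases cutting x y s n <;> simp [letterType]

theorem reads_horizontal {n v h m : ℕ} (hn : crossed x y s n = (v, h))
    (hm : (h + m : ℝ) ≤ y + s * (v + 1 - x)) :
    Reads (cutting x y s) n (List.replicate m false) ∧ crossed x y s (n + m) = (v, h + m) := by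
  induction m with
  | zero => exact ⟨trivial, hn⟩
  | succ m ih =>
    push_cast at hm
    obtain ⟨h1, h2⟩ := ih (by linarith)
    have h3 : cutting x y s (n + m) = false := by
      rw [Bool.eq_false_iff, Ne, cutting_eq_true, h2]
      push_cast
      linarith
    refine ⟨?_, ?_⟩
    · rw [List.replicate_succ', reads_append, List.length_replicate]
      exact ⟨h1, h3, trivial⟩
    · rw [← add_assoc, crossed_succ, h3, h2]; rfl

theorem reads_horizontal_vertical {n v h m : ℕ} (hn : crossed x y s n = (v, h))
    (hm : (h + m : ℝ) ≤ y + s * (v + 1 - x)) (hm' : y + s * (v + 1 - x) < h + m + 1) :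
    Reads (cutting x y s) n (List.replicate m false ++ [true]) ∧
      crossed x y s (n + m + 1) = (v + 1, h + m) := by
  obtain ⟨h1, h2⟩ := reads_horizontal hn hm
  have h3 : cutting x y s (n + m) = true := by
    rw [cutting_eq_true, h2]
    push_cast
    linarith
  refine ⟨?_, ?_⟩
  · rw [reads_append, List.length_replicate]
    exact ⟨h1, h3, trivial⟩
  · rw [crossed_succ, h3, h2]; rfl

theorem reads_blocks {n v h m : ℕ} (hn : crossed x y s n = (v, h))
    (hm : ∀ i < m, (h + 3 * i + 3 : ℝ) ≤ y + s * (v + i + 1 - x) ∧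
      y + s * (v + i + 1 - x) < h + 3 * i + 4) :
    Reads (cutting x y s) n (blocks m) ∧ crossed x y s (n + 4 * m) = (v + m, h + 3 * m) := by
  induction m with
  | zero => exact ⟨trivial, hn⟩
  | succ m ih =>
    obtain ⟨h1, h2⟩ := ih fun i hi => hm i (by omega)
    obtain ⟨h3, h4⟩ := hm m (by omega)
    have h5 := reads_horizontal_vertical (m := 3) h2 (by push_cast; linarith)
      (by push_cast; linarith)
    refine ⟨?_, ?_⟩
    · rw [blocks_add, reads_append, length_blocks]
      exact ⟨h1, h5.1⟩
    · exact h5.2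

end

/-- For the slope `3 + 1 / q` the height at which the half-line crosses a vertical line increases by
`3 + 1 / q` from line to line. So three horizontal lines are crossed in between, but a fourth one
whenever the fractional part wraps around, which happens once in `q` lines. -/
theorem reads_of_slope {x y f : ℝ} {a q : ℕ} (hq : 0 < q)
    (hg : IsGeneric x y (3 + 1 / q)) (hf0 : 0 ≤ f) (hf : y + 3 * (1 - x) = a + f)
    (hl : 17 ≤ q * (1 - f)) :
    ∃ j, 14 ≤ j ∧
      Reads (cutting x y (3 + 1 / q)) 0 (List.replicate a false ++ true :: blocks j) ∧
      ∀ m, Reads (cutting x y (3 + 1 / q)) (a + 1 + 4 * j + (4 * q + 1) * m) (word q) := by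
  have hq' : (0 : ℝ) < q := by exact_mod_cast hq
  have hs : ∀ z : ℝ, y + (3 + 1 / q) * (z + 1 - x) = a + f + 3 * z + (z + 1 - x) / q := by
    intro z
    linear_combination hf
  have hx := hg.x_pos
  have hx' := hg.x_lt
  set u : ℝ := q * (1 - f) - (1 - x) with hu
  -- the first vertical line at whose crossing the fractional part has wrapped around
  obtain ⟨i₀, hi, hi'⟩ : ∃ i₀ : ℕ, u ≤ i₀ ∧ (i₀ : ℝ) < u + 1 :=
    ⟨⌈u⌉₊, Nat.le_ceil u, Nat.ceil_lt_add_one (by linarith)⟩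
  have h16 : 16 ≤ i₀ := by
    have : (15 : ℝ) < i₀ := by linarith
    have : 15 < i₀ := by exact_mod_cast this
    omega
  obtain ⟨j, rfl⟩ : ∃ j, i₀ = j + 1 := ⟨i₀ - 1, by omega⟩
  push_cast at hi hi'
  have hlow : ∀ z : ℝ, 0 ≤ z → z ≤ j → (a + 3 * z : ℝ) ≤ y + (3 + 1 / q) * (z + 1 - x) ∧
      y + (3 + 1 / q) * (z + 1 - x) < a + 3 * z + 1 := by
    intro z hz hz'
    rw [hs]
    have h1 : 0 ≤ (z + 1 - x) / q := div_nonneg (by linarith) hq'.le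
    have h2 : (z + 1 - x) / q < 1 - f := by
      rw [div_lt_iff₀ hq', mul_comm]
      linarith
    constructor <;> linarith
  have hup : ∀ z m : ℝ, j + 1 + q * m ≤ z → z ≤ j + 1 + q * m + q - 1 →
      (a + 3 * z + m + 1 : ℝ) ≤ y + (3 + 1 / q) * (z + 1 - x) ∧
      y + (3 + 1 / q) * (z + 1 - x) < a + 3 * z + m + 2 := by
    intro z m hz hz'
    rw [hs]
    have h1 : m + (1 - f) ≤ (z + 1 - x) / q := by
      rw [le_div_iff₀ hq']; linarith
    have h2 : (z + 1 - x) / q < m + 1 + (1 - f) := by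
      rw [div_lt_iff₀ hq']; linarith
    constructor <;> linarith
  have hjr : (0 : ℝ) ≤ j := Nat.cast_nonneg _
  have hstart := reads_horizontal_vertical (x := x) (y := y) (s := 3 + 1 / q) (n := 0) (v := 0)
    (h := 0) (m := a) rfl (by simpa using (hlow 0 le_rfl hjr).1)
    (by simpa using (hlow 0 le_rfl hjr).2)
  rw [zero_add, zero_add] at hstart
  have hrun := reads_blocks (m := j) hstart.2 (fun i hi => by
    have hi1 : (i + 1 : ℝ) ≤ j := by exact_mod_cast hi
    have := hlow (i + 1) (by positivity) hi1
    push_cast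
    rw [add_comm (1 : ℝ)]
    constructor <;> linarith)
  have hword : ∀ m v h : ℕ, v = j + 1 + q * m → h = a + 3 * j + (3 * q + 1) * m →
      ∀ n, crossed x y (3 + 1 / q) n = (v, h) →
      Reads (cutting x y (3 + 1 / q)) n (word q) ∧
        crossed x y (3 + 1 / q) (n + (4 * q + 1)) = (v + q, h + (3 * q + 1)) := by
    intro m v h hv hh n hn
    have hv' : (v : ℝ) = j + 1 + q * m := by rw [hv]; push_cast; ring
    have hh' : (h : ℝ) = a + 3 * j + (3 * q + 1) * m := by rw [hh]; push_cast; ring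
    have hq1 : (1 : ℝ) ≤ q := by exact_mod_cast hq
    obtain ⟨h1, h2⟩ := reads_horizontal (m := 1) hn (by
      have := (hup v m hv'.ge (by linarith)).1
      push_cast
      linarith)
    obtain ⟨h3, h4⟩ := reads_blocks (m := q) h2 (fun i hi => by
      have hi1 : (i + 1 : ℝ) ≤ q := by exact_mod_cast hi
      have hi0 : (0 : ℝ) ≤ i := Nat.cast_nonneg _
      have := hup (v + i) m (by linarith) (by linarith)
      push_cast
      constructor <;> linarith)
    refine ⟨⟨h1.1, h3⟩, ?_⟩
    rw [show n + (4 * q + 1) = n + 1 + 4 * q by ring, h4]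
    ext <;> simp only
    ring
  have hall : ∀ m : ℕ, crossed x y (3 + 1 / q) (a + 1 + 4 * j + (4 * q + 1) * m) =
      (j + 1 + q * m, a + 3 * j + (3 * q + 1) * m) := by
    intro m
    induction m with
    | zero =>
      rw [mul_zero, add_zero, hrun.2]
      ext <;> simp only <;> ring
    | succ m ih =>
      rw [mul_add, mul_one, ← add_assoc, (hword m _ _ rfl rfl _ ih).2]
      ext <;> simp only <;> ring
  refine ⟨j, by omega, ?_, fun m => (hword m _ _ rfl rfl _ (hall m)).1⟩
  rw [← List.singleton_append, ← List.append_assoc, reads_append]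
  refine ⟨hstart.1, ?_⟩
  convert hrun.1 using 1
  simp

/-! ### From the combinatorial system to the particle -/

/-- The midpoint of a wall, in coordinates scaled by two. -/
def Wall.mid (w : Wall) : ℤ × ℤ :=
  match w.type with
  | WallType.horizontal => (2 * w.base.1 + 1, 2 * w.base.2)
  | WallType.vertical => (2 * w.base.1, 2 * w.base.2 + 1)

/-- The inverse of `Wall.mid`: a wall is vertical if the first coordinate of its midpoint is even. -/
def wallOf (e : ℤ × ℤ) : Wall := ⟨letterType (decide (e.1 % 2 = 0)), (e.1 / 2, e.2 / 2)⟩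

theorem wallOf_mid (w : Wall) : wallOf w.mid = w := by
  obtain ⟨_ | _, a, b⟩ := w
  · have h : ¬ (2 * a + 1) % 2 = 0 := by omega
    have h1 : (2 * a + 1) / 2 = a := by omega
    have h2 : 2 * b / 2 = b := by omega
    change (⟨letterType (decide ((2 * a + 1) % 2 = 0)), ((2 * a + 1) / 2, 2 * b / 2)⟩ : Wall) = _
    rw [decide_eq_false h, h1, h2]; rfl
  · have h : 2 * a % 2 = 0 := by omega
    have h1 : 2 * a / 2 = a := by omega
    have h2 : (2 * b + 1) / 2 = b := by omega
    change (⟨letterType (decide (2 * a % 2 = 0)), (2 * a / 2, (2 * b + 1) / 2)⟩ : Wall) = _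
    rw [decide_eq_true h, h1, h2]; rfl

theorem mid_wallOf {e : ℤ × ℤ} (h : (e.1 + e.2) % 2 = 1) : (wallOf e).mid = e := by
  obtain ⟨a, b⟩ := e
  simp only at h
  by_cases ha : a % 2 = 0
  · simp only [Wall.mid, wallOf, decide_eq_true ha, letterType, cond_true, Prod.mk.injEq]
    omega
  · simp only [Wall.mid, wallOf, decide_eq_false ha, letterType, cond_false, Prod.mk.injEq]
    omega

theorem lt_add_one_of_cast {a b : ℤ} (h : (a : ℝ) < b + 1) : a < b + 1 := by exact_mod_cast h

theorem mem_segment_vertical {p : Plane} {a b : ℤ} (h0 : p 0 = a) (h1 : (b : ℝ) < p 1)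
    (h2 : p 1 < b + 1) (w : Wall) : p ∈ w.segment ↔ w.mid = (2 * a, 2 * b + 1) := by
  obtain ⟨_ | _, c, d⟩ := w
  · simp only [Wall.segment, Set.mem_ofPred_eq, Wall.mid, Prod.mk.injEq]
    constructor
    · rintro ⟨-, -, (h : p 1 = d)⟩
      rw [h] at h1 h2
      have h1 : b < d := Int.cast_lt.1 h1
      have h2 : d < b + 1 := lt_add_one_of_cast (h2)
      omega
    · omega
  · simp only [Wall.segment, Set.mem_ofPred_eq, Wall.mid, Prod.mk.injEq]
    constructor
    · rintro ⟨(h : p 0 = c), (h3 : (d : ℝ) ≤ p 1), (h4 : p 1 ≤ d + 1)⟩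
      have h5 : a = c := Int.cast_injective (α := ℝ) (h0.symm.trans h)
      have h6 : d < b + 1 := lt_add_one_of_cast (h3.trans_lt h2)
      have h7 : b < d + 1 := lt_add_one_of_cast (h1.trans_le h4)
      omega
    · rintro ⟨h3, h4⟩
      obtain rfl : c = a := by omega
      obtain rfl : d = b := by omega
      exact ⟨h0, h1.le, h2.le⟩

theorem mem_segment_horizontal {p : Plane} {a b : ℤ} (h0 : p 1 = b) (h1 : (a : ℝ) < p 0)
    (h2 : p 0 < a + 1) (w : Wall) : p ∈ w.segment ↔ w.mid = (2 * a + 1, 2 * b) := by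
  obtain ⟨_ | _, c, d⟩ := w
  · simp only [Wall.segment, Set.mem_ofPred_eq, Wall.mid, Prod.mk.injEq]
    constructor
    · rintro ⟨(h3 : (c : ℝ) ≤ p 0), (h4 : p 0 ≤ c + 1), (h : p 1 = d)⟩
      have h5 : b = d := Int.cast_injective (α := ℝ) (h0.symm.trans h)
      have h6 : c < a + 1 := lt_add_one_of_cast (h3.trans_lt h2)
      have h7 : a < c + 1 := lt_add_one_of_cast (h1.trans_le h4)
      omega
    · rintro ⟨h3, h4⟩
      obtain rfl : c = a := by omega
      obtain rfl : d = b := by omega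
      exact ⟨h1.le, h2.le, h0⟩
  · simp only [Wall.segment, Set.mem_ofPred_eq, Wall.mid, Prod.mk.injEq]
    constructor
    · rintro ⟨(h : p 0 = c), -, -⟩
      rw [h] at h1 h2
      have h1 : a < c := Int.cast_lt.1 h1
      have h2 : c < a + 1 := lt_add_one_of_cast (h2)
      omega
    · omega

theorem not_isInt_of_mem {z : ℝ} {a : ℤ} (h1 : (a : ℝ) < z) (h2 : z < a + 1) : ¬ IsInt z := by
  rintro ⟨n, rfl⟩
  have h1 : a < n := by exact_mod_cast h1
  have h2 : n < a + 1 := by exact_mod_cast h2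
  omega

theorem isInt_of_mem_segment {p : Plane} {w : Wall} (h : p ∈ w.segment) :
    IsInt (p 0) ∨ IsInt (p 1) := by
  obtain ⟨_ | _, c, d⟩ := w
  · exact Or.inr ⟨d, h.2.2⟩
  · exact Or.inl ⟨c, h.1⟩

/-- A coordinate of a point in the cell with midpoint `p / 2`: the particle has travelled the fraction
`u` of the way across the cell, in the direction of the sign `d`. -/
noncomputable def foldCoord (p d : ℤ) (u : ℝ) : ℝ := (p + d * (2 * u - 1)) / 2

theorem foldCoord_mem {p d : ℤ} {u : ℝ} (hd : d = 1 ∨ d = -1) (hp : Odd p) (h0 : 0 < u)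
    (h1 : u < 1) : ((p / 2 : ℤ) : ℝ) < foldCoord p d u ∧ foldCoord p d u < (p / 2 : ℤ) + 1 := by
  obtain ⟨m, rfl⟩ := hp
  have : (2 * m + 1) / 2 = m := by omega
  rw [this, foldCoord]
  rcases hd with rfl | rfl <;> push_cast <;> constructor <;> linarith

theorem foldCoord_one {p d : ℤ} (hd : d = 1 ∨ d = -1) (hp : Odd p) :
    foldCoord p d 1 = ((p + d) / 2 : ℤ) := by
  obtain ⟨m, rfl⟩ := hp
  rw [foldCoord]
  rcases hd with rfl | rfl
  · rw [show (2 * m + 1 + 1) / 2 = m + 1 by omega]; push_cast; ring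
  · rw [show (2 * m + 1 + -1) / 2 = m by omega]; push_cast; ring

/-- The position of the particle at time `t`, when `n` lines have been crossed by the straight
half-line. Without the collisions the particle would follow the half-line; each collision folds the
rest of its path. -/
noncomputable def location (x y s : ℝ) (n : ℕ) (t : ℝ) : Plane :=
  !₂[foldCoord (orbit (cutting x y s) n).pos.1 (orbit (cutting x y s) n).dir.1
      (x + t - (crossed x y s n).1),
    foldCoord (orbit (cutting x y s) n).pos.2 (orbit (cutting x y s) n).dir.2
      (y + s * t - (crossed x y s n).2)]

/-- The velocity of the particle when `n` lines have been crossed. -/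
noncomputable def velocity (x y s : ℝ) (n : ℕ) : Plane :=
  !₂[((orbit (cutting x y s) n).dir.1 : ℝ), (orbit (cutting x y s) n).dir.2 * s]

/-- The walls that are still solid when `n` lines have been crossed. -/
noncomputable def solidWalls (x y s : ℝ) (n : ℕ) : Set Wall :=
  {w | w.mid ∉ (orbit (cutting x y s) n).erased}

section
variable {x y s : ℝ}

theorem location_add (n : ℕ) (t u : ℝ) :
    location x y s n t + u • velocity x y s n = location x y s n (t + u) := by
  ext i
  fin_cases i <;> simp [location, velocity, foldCoord] <;> ring

theorem location_succ_of_not_hit {n : ℕ} (h : ¬ HitAt (cutting x y s) n) :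
    location x y s (n + 1) = location x y s n := by
  funext t
  have h' := not_not.1 h
  rw [location, location, orbit, Cfg.step, if_pos h', crossed_succ]
  ext i
  cases hc : cutting x y s n <;> fin_cases i <;> simp [ahead, foldCoord] <;> ring

theorem velocity_succ_of_not_hit {n : ℕ} (h : ¬ HitAt (cutting x y s) n) :
    velocity x y s (n + 1) = velocity x y s n := by
  rw [velocity, velocity, orbit, Cfg.step, if_pos (not_not.1 h)]

theorem solidWalls_succ_of_not_hit {n : ℕ} (h : ¬ HitAt (cutting x y s) n) :
    solidWalls x y s (n + 1) = solidWalls x y s n := by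
  rw [solidWalls, solidWalls, orbit, Cfg.step, if_pos (not_not.1 h)]

theorem front_eq {S : Cfg} (b : Bool) : S.front b =
    bif b then (S.pos.1 + S.dir.1, S.pos.2) else (S.pos.1, S.pos.2 + S.dir.2) := by
  simp [Cfg.front, ahead]

theorem front_parity (c : ℕ → Bool) (n : ℕ) :
    (((orbit c n).front (c n)).1 + ((orbit c n).front (c n)).2) % 2 = 1 ∧
      (decide (((orbit c n).front (c n)).1 % 2 = 0)) = c n := by
  obtain ⟨⟨h1, h2⟩, h3, h4⟩ := orbit_odd c n
  rw [Int.odd_iff] at h1 h2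
  rw [front_eq]
  cases c n
  · simp only [cond_false, decide_eq_false_iff_not]; omega
  · simp only [cond_true, decide_eq_true_eq]; omega

theorem IsGeneric.location_of_hit (hg : IsGeneric x y s) {n : ℕ} (h : HitAt (cutting x y s) n) :
    location x y s (n + 1) (crossTime x y s n) = location x y s n (crossTime x y s n) := by
  rw [location, location, orbit, Cfg.step, if_neg h, crossed_succ]
  ext i
  cases hc : cutting x y s n
  · have h1 := hg.mul_crossTime hc
    fin_cases i
    · simp [flipDir]
    · simp only [flipDir, foldCoord, h1, cond_false]
      simp; ring
  · have h1 := crossTime_of_true hc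
    fin_cases i
    · simp only [flipDir, foldCoord, h1, cond_true]
      simp; ring
    · simp [flipDir]

theorem velocity_of_hit {n : ℕ} (h : HitAt (cutting x y s) n) :
    velocity x y s (n + 1) = reflect (letterType (cutting x y s n)) (velocity x y s n) := by
  rw [velocity, velocity, orbit, Cfg.step, if_neg h]
  cases cutting x y s n <;> simp [flipDir, reflect, letterType]

theorem IsGeneric.not_isInt_location (hg : IsGeneric x y s) {n : ℕ} {t : ℝ}
    (h1 : stageStart x y s n < t) (h2 : t < crossTime x y s n) :
    ¬ IsInt (location x y s n t 0) ∧ ¬ IsInt (location x y s n t 1) := by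
  obtain ⟨⟨h3, h4⟩, h5, h6⟩ := hg.mem_cell h1 h2
  obtain ⟨⟨h7, h8⟩, h9, h10⟩ := orbit_odd (cutting x y s) n
  have h11 := foldCoord_mem (u := x + t - (crossed x y s n).1) h9 h7 (by linarith) (by linarith)
  have h12 := foldCoord_mem (u := y + s * t - (crossed x y s n).2) h10 h8 (by linarith)
    (by linarith)
  exact ⟨not_isInt_of_mem h11.1 h11.2, not_isInt_of_mem h12.1 h12.2⟩

theorem IsGeneric.location_crossTime (hg : IsGeneric x y s) (n : ℕ) :
    ¬ IsCorner (location x y s n (crossTime x y s n)) ∧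
    ∀ w : Wall, location x y s n (crossTime x y s n) ∈ w.segment ↔
      w.mid = (orbit (cutting x y s) n).front (cutting x y s n) := by
  obtain ⟨⟨h7, h8⟩, h9, h10⟩ := orbit_odd (cutting x y s) n
  rw [front_eq]
  cases hc : cutting x y s n
  · have h1 := hg.mul_crossTime hc
    have h2 : ((crossed x y s n).1 : ℝ) < x + crossTime x y s n ∧
        x + crossTime x y s n < (crossed x y s n).1 + 1 := by
      have h3 := hg.lt_of_not_cutting hc
      have h4 := hg.bounds n
      have hs := hg.s_pos
      constructor <;>
      · by_contra! h5
        nlinarith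
    have h11 := foldCoord_mem (u := x + crossTime x y s n - (crossed x y s n).1) h9 h7
      (by linarith) (by linarith)
    have h12 : location x y s n (crossTime x y s n) 1 = (((orbit (cutting x y s) n).pos.2 +
        (orbit (cutting x y s) n).dir.2) / 2 : ℤ) := by
      rw [← foldCoord_one h10 h8]
      simp [location, h1]
    refine ⟨fun h => not_isInt_of_mem h11.1 h11.2 h.1, fun w => ?_⟩
    rw [mem_segment_horizontal h12 h11.1 h11.2, Iff.comm]
    rw [Int.odd_iff] at h7 h8
    have e1 : 2 * ((orbit (cutting x y s) n).pos.1 / 2) + 1 = (orbit (cutting x y s) n).pos.1 := by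
      omega
    have e2 : 2 * (((orbit (cutting x y s) n).pos.2 + (orbit (cutting x y s) n).dir.2) / 2) =
        (orbit (cutting x y s) n).pos.2 + (orbit (cutting x y s) n).dir.2 := by omega
    rw [e1, e2]; rfl
  · have h1 := crossTime_of_true hc
    have h2 := cutting_eq_true.1 hc
    have h3 := (hg.bounds n).1
    rw [← h1] at h2 h3
    have h11 := foldCoord_mem (u := y + s * crossTime x y s n - (crossed x y s n).2) h10 h8
      (by linarith) (by linarith)
    have h12 : location x y s n (crossTime x y s n) 0 = (((orbit (cutting x y s) n).pos.1 +
        (orbit (cutting x y s) n).dir.1) / 2 : ℤ) := by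
      rw [← foldCoord_one h9 h7]
      simp [location, h1]
    refine ⟨fun h => not_isInt_of_mem h11.1 h11.2 h.2, fun w => ?_⟩
    rw [mem_segment_vertical h12 h11.1 h11.2, Iff.comm]
    rw [Int.odd_iff] at h7 h8
    have e1 : 2 * ((orbit (cutting x y s) n).pos.2 / 2) + 1 = (orbit (cutting x y s) n).pos.2 := by
      omega
    have e2 : 2 * (((orbit (cutting x y s) n).pos.1 + (orbit (cutting x y s) n).dir.1) / 2) =
        (orbit (cutting x y s) n).pos.1 + (orbit (cutting x y s) n).dir.1 := by omega
    rw [e1, e2]; rfl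

theorem exists_between_succ {f : ℕ → ℝ} {n N : ℕ} {t : ℝ} (hn : n ≤ N) (h1 : f n < t)
    (h2 : t ≤ f (N + 1)) : ∃ m, n ≤ m ∧ m ≤ N ∧ f m < t ∧ t ≤ f (m + 1) := by
  induction N, hn using Nat.le_induction with
  | base => exact ⟨n, le_rfl, le_rfl, h1, h2⟩
  | succ N hN ih =>
    by_cases h : t ≤ f (N + 1)
    · obtain ⟨m, h3, h4, h5⟩ := ih h
      exact ⟨m, h3, by omega, h5⟩
    · exact ⟨N + 1, by omega, le_rfl, not_le.1 h, h2⟩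

/-- The state of the particle right after `n` lines have been crossed. -/
noncomputable def stateAt (x y s : ℝ) (n : ℕ) : State :=
  ⟨location x y s n (stageStart x y s n), velocity x y s n, solidWalls x y s n⟩

/-- Up to the next letter with a collision, the particle moves on in a straight line: it crosses only
walls that are gone, through their interiors. -/
theorem IsGeneric.collides (hg : IsGeneric x y s) {n N : ℕ} (hnN : n ≤ N)
    (hno : ∀ m, n ≤ m → m < N → ¬ HitAt (cutting x y s) m) (hN : HitAt (cutting x y s) N) :
    Collides (stateAt x y s n)
      (wallOf ((orbit (cutting x y s) N).front (cutting x y s N))) (stateAt x y s (N + 1)) := by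
  have hconst : ∀ m, n ≤ m → m ≤ N → location x y s m = location x y s n ∧
      velocity x y s m = velocity x y s n ∧ solidWalls x y s m = solidWalls x y s n := by
    intro m hm
    induction m, hm using Nat.le_induction with
    | base => exact fun _ => ⟨rfl, rfl, rfl⟩
    | succ m hm ih =>
      intro hmN
      obtain ⟨h1, h2, h3⟩ := ih (by omega)
      have h := hno m hm (by omega)
      rw [location_succ_of_not_hit h, velocity_succ_of_not_hit h, solidWalls_succ_of_not_hit h]
      exact ⟨h1, h2, h3⟩
  obtain ⟨c1, c2, c3⟩ := hconst N hnN le_rfl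
  have hpar := front_parity (cutting x y s) N
  have hmid := mid_wallOf hpar.1
  have hpos : stageStart x y s n < stageStart x y s (N + 1) := hg.strictMono (by omega)
  have hstage : ∀ u : ℝ, 0 < u → u ≤ crossTime x y s N - stageStart x y s n →
      ∃ m, n ≤ m ∧ m ≤ N ∧ stageStart x y s m < stageStart x y s n + u ∧
        stageStart x y s n + u ≤ crossTime x y s m ∧
        location x y s n (stageStart x y s n + u) = location x y s m (stageStart x y s n + u) := by
    intro u h0 h1
    obtain ⟨m, h2, h3, h4, h5⟩ := exists_between_succ (f := stageStart x y s)
      (t := stageStart x y s n + u) hnN (by linarith) (by rw [stageStart]; linarith)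
    exact ⟨m, h2, h3, h4, h5, by rw [(hconst m h2 h3).1]⟩
  refine ⟨crossTime x y s N - stageStart x y s n, sub_pos.2 hpos, ?_, ?_, ?_, ?_, ?_⟩
  · rw [stateAt, ← c3]
    change (wallOf _).mid ∉ _
    rw [hmid]; exact hN
  · simp only [stateAt]
    rw [location_add, add_sub_cancel, ← c1, (hg.location_crossTime N).2, hmid]
  · intro u h0 h1
    simp only [stateAt]
    rw [location_add]
    obtain ⟨m, h2, h3, h4, h5, h6⟩ := hstage u h0 h1
    rw [h6]
    rcases h5.lt_or_eq with h5 | h5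
    · exact fun h => (hg.not_isInt_location h4 h5).1 h.1
    · rw [h5]; exact (hg.location_crossTime m).1
  · intro u h0 h1 w hw
    simp only [stateAt] at hw ⊢
    rw [location_add]
    obtain ⟨m, h2, h3, h4, h5, h6⟩ := hstage u h0 h1.le
    rw [h6]
    rcases h5.lt_or_eq with h5 | h5
    · intro h
      have := hg.not_isInt_location h4 h5
      exact (isInt_of_mem_segment h).elim this.1 this.2
    · have hmN : m < N := by
        refine lt_of_le_of_ne h3 ?_
        rintro rfl
        linarith
      rw [h5, (hg.location_crossTime m).2]
      intro h
      rw [← (hconst m h2 h3).2.2] at hw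
      exact hw (h ▸ not_not.1 (hno m h2 hmN))
  · simp only [stateAt]
    rw [location_add, add_sub_cancel, stageStart, hg.location_of_hit hN, velocity_of_hit hN, c1, c2,
      ← c3]
    congr 1
    · simp only [wallOf, hpar.2]
    · ext w
      simp only [solidWalls, Set.mem_sdiff, Set.mem_ofPred_eq, Set.mem_singleton_iff, orbit,
        Cfg.step, if_neg (show ¬ _ from hN), Set.mem_insert_iff, not_or]
      rw [and_comm, ← hmid]
      have : w.mid = (wallOf ((orbit (cutting x y s) N).front (cutting x y s N))).mid ↔
          w = wallOf ((orbit (cutting x y s) N).front (cutting x y s N)) := by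
        constructor
        · intro h
          rw [← wallOf_mid w, h, wallOf_mid]
        · rintro rfl; rfl
      rw [this, hmid]

end

theorem isCollisionSequence {P : Plane} {s : ℝ} (hg : IsGeneric (P 0) (P 1) s)
    (hinf : {n | HitAt (cutting (P 0) (P 1) s) n}.Infinite) :
    IsCollisionSequence P s fun i => wallOf (hitPoint (cutting (P 0) (P 1) s) i) := by
  refine ⟨fun i => stateAt (P 0) (P 1) s
    (Nat.casesOn i 0 fun i => hitTime (cutting (P 0) (P 1) s) i + 1), ?_, fun i => ?_⟩
  · simp only [stateAt, State.mk.injEq]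
    refine ⟨?_, ?_, ?_⟩
    · ext i
      fin_cases i <;> simp [location, orbit, start, crossed, foldCoord, stageStart]
    · simp [velocity, orbit, start]
    · simp [solidWalls, orbit, start]
  · refine hg.collides ?_ ?_ (Nat.nth_mem_of_infinite hinf i)
    · cases i with
      | zero => exact Nat.zero_le _
      | succ i => exact Nat.nth_strictMono hinf (Nat.lt_succ_self i)
    · classical
      intro m hm hm' hhit
      rw [hitTime, ← Nat.nth_count hhit, (Nat.nth_strictMono hinf).lt_iff_lt] at hm'
      cases i with
      | zero => exact absurd hm' (Nat.not_lt_zero _)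
      | succ i =>
        have h1 : hitTime (cutting (P 0) (P 1) s) i < m := hm
        rw [hitTime, ← Nat.nth_count hhit, (Nat.nth_strictMono hinf).lt_iff_lt] at h1
        omega

/-! ### Eventually periodic sequences of walls dig tunnels -/

/-- The integer vector `a`, as a vector of the plane. -/
noncomputable def toPlane (a : ℤ × ℤ) : Plane := !₂[(a.1 : ℝ), (a.2 : ℝ)]

theorem toPlane_add (a b : ℤ × ℤ) : toPlane (a + b) = toPlane a + toPlane b := by
  ext i; fin_cases i <;> simp [toPlane]

theorem toPlane_nsmul (m : ℕ) (a : ℤ × ℤ) : toPlane (m • a) = (m : ℝ) • toPlane a := by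
  ext i; fin_cases i <;> simp [toPlane]

theorem toPlane_ne_zero {a : ℤ × ℤ} (h : a ≠ 0) : toPlane a ≠ 0 := by
  intro h'
  refine h (Prod.ext ?_ ?_)
  · simpa [toPlane] using congrArg (fun p : Plane => p 0) h'
  · simpa [toPlane] using congrArg (fun p : Plane => p 1) h'

theorem base_mem_segment (w : Wall) : toPlane w.base ∈ w.segment := by
  obtain ⟨_ | _, a⟩ := w <;> simp [Wall.segment, toPlane]

theorem norm_sub_base_le {w : Wall} {p : Plane} (hp : p ∈ w.segment) :
    ‖p - toPlane w.base‖ ≤ 1 := by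
  rw [EuclideanSpace.norm_eq, Fin.sum_univ_two, Real.sqrt_le_iff]
  refine ⟨zero_le_one, ?_⟩
  simp only [Real.norm_eq_abs, sq_abs]
  obtain ⟨_ | _, a⟩ := w
  · obtain ⟨h1, h2, h3⟩ := hp
    simp [toPlane] at h1 h2 h3 ⊢
    rw [h3]
    nlinarith
  · obtain ⟨h1, h2, h3⟩ := hp
    simp [toPlane] at h1 h2 h3 ⊢
    rw [h1]
    nlinarith

/-- From `n₀` on, the walls are periodic with period `k₀` up to the translation by `E ≠ 0`. -/
structure EventuallyTranslates (w : ℕ → Wall) (k₀ n₀ : ℕ) (E : ℤ × ℤ) : Prop where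
  period_pos : 0 < k₀
  ne_zero : E ≠ 0
  type_add : ∀ n, n₀ ≤ n → (w (n + k₀)).type = (w n).type
  base_add : ∀ n, n₀ ≤ n → (w (n + k₀)).base = (w n).base + E

namespace EventuallyTranslates
variable {w : ℕ → Wall} {k₀ n₀ : ℕ} {E : ℤ × ℤ}

/-- All walls lie within a bounded distance of the points `m • E`, and the wall `n` close to the one
with `m = (n - n₀) / k₀`, which is `0` for `n < n₀`. -/
theorem exists_bound (h : EventuallyTranslates w k₀ n₀ E) : ∃ C : ℝ, 0 ≤ C ∧
    (∀ n < n₀, ‖toPlane (w n).base‖ ≤ C) ∧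
    ∀ n, ∀ p ∈ (w n).segment, ‖p - (((n - n₀) / k₀ : ℕ) : ℝ) • toPlane E‖ ≤ C + 1 := by
  have hC : ∀ n < n₀ + k₀, ‖toPlane (w n).base‖ ≤
      ∑ i ∈ Finset.range (n₀ + k₀), ‖toPlane (w i).base‖ := fun n hn =>
    Finset.single_le_sum (f := fun i => ‖toPlane (w i).base‖) (fun i _ => norm_nonneg _)
      (Finset.mem_range.2 hn)
  refine ⟨_, Finset.sum_nonneg fun i _ => norm_nonneg _, fun n hn => hC n (by omega), ?_⟩
  intro n p hp
  have h1 := norm_sub_base_le hp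
  have h2 : ‖toPlane (w n).base - (((n - n₀) / k₀ : ℕ) : ℝ) • toPlane E‖ ≤
      ∑ i ∈ Finset.range (n₀ + k₀), ‖toPlane (w i).base‖ := by
    rcases lt_or_ge n n₀ with hn | hn
    · rw [show n - n₀ = 0 by omega]
      simpa using hC n (by omega)
    · have e : n = n₀ + (n - n₀) % k₀ + k₀ * ((n - n₀) / k₀) := by
        have := Nat.mod_add_div (n - n₀) k₀
        omega
      have hlt := Nat.mod_lt (n - n₀) h.period_pos
      generalize (n - n₀) / k₀ = m at e ⊢
      generalize (n - n₀) % k₀ = i at e hlt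
      have := add_mul_of_add (f := fun n => (w n).base) h.base_add
        (show n₀ ≤ n₀ + i by omega) m
      rw [e, this, toPlane_add, toPlane_nsmul, add_sub_cancel_right]
      exact hC _ (by omega)
  calc _ = ‖(p - toPlane (w n).base) + (toPlane (w n).base -
        (((n - n₀) / k₀ : ℕ) : ℝ) • toPlane E)‖ := by rw [sub_add_sub_cancel]
    _ ≤ _ := by linarith [norm_add_le (p - toPlane (w n).base) (toPlane (w n).base -
        (((n - n₀) / k₀ : ℕ) : ℝ) • toPlane E)]

theorem eventually_outsideDisc (h : EventuallyTranslates w k₀ n₀ E) (r : ℝ) :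
    ∀ᶠ n in Filter.atTop, (w n).OutsideDisc r := by
  obtain ⟨C, -, -, hC⟩ := h.exists_bound
  have hE : 0 < ‖toPlane E‖ := norm_pos_iff.2 (toPlane_ne_zero h.ne_zero)
  obtain ⟨M, hM⟩ := exists_nat_gt ((r + C + 1) / ‖toPlane E‖)
  rw [div_lt_iff₀ hE] at hM
  refine Filter.eventually_atTop.2 ⟨n₀ + k₀ * M, fun n hn p hp => ?_⟩
  have h1 := hC n p hp
  have h2 : (M : ℝ) ≤ ((n - n₀) / k₀ : ℕ) := by
    have : M ≤ (n - n₀) / k₀ := by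
      rw [Nat.le_div_iff_mul_le h.period_pos, mul_comm]; omega
    exact_mod_cast this
  have h3 := norm_sub_norm_le ((((n - n₀) / k₀ : ℕ) : ℝ) • toPlane E) p
  rw [norm_smul, norm_sub_rev, Real.norm_eq_abs, abs_of_nonneg (Nat.cast_nonneg _)] at h3
  have h4 := mul_le_mul_of_nonneg_right h2 hE.le
  linarith

theorem exists_covers (h : EventuallyTranslates w k₀ n₀ E) :
    ∃ B : Fin 1 → Band, ∀ r, Covers w r B := by
  obtain ⟨C, hC0, -, hC⟩ := h.exists_bound
  refine ⟨fun _ => ⟨0, toPlane E, toPlane_ne_zero h.ne_zero, C + 1, by linarith⟩,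
    fun r n _ => ⟨0, fun p hp => ⟨((n - n₀) / k₀ : ℕ), Nat.cast_nonneg _, ?_⟩⟩⟩
  rw [zero_add, dist_eq_norm]
  exact hC n p hp

theorem isLeast_one (h : EventuallyTranslates w k₀ n₀ E) :
    IsLeast {m | TunnelsInBands w m} 1 := by
  constructor
  · obtain ⟨B, hB⟩ := h.exists_covers
    exact ⟨0, B, hB 0⟩
  · rintro m ⟨r, B, hB⟩
    obtain ⟨n, hn⟩ := (h.eventually_outsideDisc r).exists
    obtain ⟨i, -⟩ := hB n hn
    have := i.2
    omega

theorem isShift (h : EventuallyTranslates w k₀ n₀ E) : IsShift w k₀ := by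
  obtain ⟨C, -, hC, -⟩ := h.exists_bound
  obtain ⟨B, hB⟩ := h.exists_covers
  refine ⟨h.period_pos, 1, h.isLeast_one, C, fun r hr => ⟨B, hB r, fun _ => E, fun n hn => ?_⟩⟩
  have hn0 : n₀ ≤ n := by
    by_contra! hlt
    have h1 := hC n hlt
    have h2 := hn _ (base_mem_segment (w n))
    linarith
  exact ⟨h.type_add n hn0, fun _ _ => by rw [h.base_add n hn0, add_sub_cancel_left]⟩

/-- As one band suffices, the displacement of an admissible shift is eventually constant. -/
theorem exists_of_isShift (h : EventuallyTranslates w k₀ n₀ E) {k : ℕ} (hk : IsShift w k) :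
    ∃ d : ℤ × ℤ, ∀ᶠ n in Filter.atTop, (w (n + k)).type = (w n).type ∧
      (w (n + k)).base = (w n).base + d := by
  obtain ⟨-, m, hm, R, hR⟩ := hk
  obtain rfl := hm.unique h.isLeast_one
  obtain ⟨B, hB, d, hd⟩ := hR R le_rfl
  refine ⟨d 0, (h.eventually_outsideDisc R).mono fun n hn => ?_⟩
  obtain ⟨h1, h2⟩ := hd n hn
  obtain ⟨i, hi⟩ := hB n hn
  obtain rfl : i = 0 := Subsingleton.elim _ _
  exact ⟨h1, by rw [← h2 0 hi, add_sub_cancel]⟩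

end EventuallyTranslates

theorem exists_digsPeriodicTunnel {c : ℕ → Bool} {D : ℤ × ℤ} {k₀ n₀ r : ℕ}
    (h : Digs c D k₀ n₀ r) :
    ∃ k, r ≤ k ∧ DigsPeriodicTunnel (fun i => wallOf (hitPoint c i)) k := by
  have hper : EventuallyTranslates (fun i => wallOf (hitPoint c i)) k₀ n₀ (D.1 / 2, D.2 / 2) := by
    obtain ⟨h1, h2⟩ := h.even
    rw [Int.even_iff] at h1 h2
    refine ⟨h.period_pos, fun h0 => h.ne_zero ?_, fun n hn => ?_, fun n hn => ?_⟩
    · rw [Prod.mk_eq_zero] at h0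
      ext <;> simp only [Prod.fst_zero, Prod.snd_zero] <;> omega
    · simp only [wallOf, h.periodic n hn, Prod.fst_add]
      congr 2
      rw [eq_iff_iff]
      omega
    · simp only [wallOf, h.periodic n hn, Prod.fst_add, Prod.snd_add, Prod.mk_add_mk, Prod.mk.injEq]
      omega
  have hmid : ∀ i, (wallOf (hitPoint c i)).mid = hitPoint c i := fun i =>
    mid_wallOf (front_parity c _).1
  have hex : ∃ k, IsShift (fun i => wallOf (hitPoint c i)) k := ⟨k₀, hper.isShift⟩
  classical
  refine ⟨Nat.find hex, ?_, ⟨1, hper.isLeast_one.1⟩, Nat.find_spec hex,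
    fun k hk => Nat.find_min' hex hk⟩
  by_contra! hlt
  have hk := Nat.find_spec hex
  obtain ⟨d, hd⟩ := hper.exists_of_isShift hk
  refine hk.1.ne' (h.straight (2 * d.1, 2 * d.2) _ hlt.le (hd.mono fun n hn => ?_))
  have e1 := hmid (n + Nat.find hex)
  have e2 := hmid n
  obtain ⟨ht, hb⟩ := hn
  generalize wallOf (hitPoint c (n + Nat.find hex)) = w' at *
  generalize wallOf (hitPoint c n) = w at *
  rw [← e1, ← e2, Wall.mid, Wall.mid, ht, hb]
  cases w.type <;> ext <;> simp only [Prod.fst_add, Prod.snd_add] <;> ring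

/-! ### The choice of the slope -/

/-- If the slopes for `q` and for `q + 1` both lead to a vertex, then `y - 3 * x` is an integer, and so
is `x`. -/
theorem isGeneric_or {x y : ℝ} (hx : 0 < x ∧ x < 1) (hy : 0 < y ∧ y < 1) {q : ℕ} (hq : 0 < q) :
    IsGeneric x y (3 + 1 / (q : ℕ)) ∨ IsGeneric x y (3 + 1 / (q + 1 : ℕ)) := by
  have key : ∀ q : ℕ, 0 < q → ¬ IsGeneric x y (3 + 1 / (q : ℕ)) →
      ∃ z : ℤ, q * (y - 3 * x) - x = z := by
    intro q hq hg
    by_contra! h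
    refine hg ⟨hx.1, hx.2, hy.1, hy.2, by positivity, fun i j hij => ?_⟩
    have hq' : (q : ℝ) ≠ 0 := by positivity
    refine h (j * q - 3 * q * i - i) ?_
    field_simp at hij
    push_cast
    linarith
  by_contra! h
  obtain ⟨z, hz⟩ := key q hq h.1
  obtain ⟨z', hz'⟩ := key (q + 1) (by omega) h.2
  -- the difference of the two integers is `y - 3 * x`, and then `x` is an integer as well
  have e : x = ((q * (z' - z) - z : ℤ) : ℝ) := by
    push_cast at hz' ⊢
    linear_combination (q : ℝ) * (hz' - hz) - hz
  have h1 := hx.1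
  have h2 := hx.2
  rw [e] at h1 h2
  have h1 : 0 < q * (z' - z) - z := by exact_mod_cast h1
  have h2 : q * (z' - z) - z < 1 := by exact_mod_cast h2
  omega

end BombBilliards


theorem corollary6p6 (P : BombBilliards.Plane)
    (hx : 0 < P 0 ∧ P 0 < 1) (hy : 0 < P 1 ∧ P 1 < 1)
    (N : ℕ) (δ : ℝ) (hδ : 0 < δ) :
    ∃ s : ℚ, (3 : ℝ) < s ∧ (s : ℝ) < 3 + δ ∧
      (∃ c : ℕ → BombBilliards.WallType, BombBilliards.IsCuttingSequence P s c ∧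
        ∃ q, N ≤ q ∧ BombBilliards.IsLeastPeriod c q) ∧
      ∃ w : ℕ → BombBilliards.Wall, BombBilliards.IsCollisionSequence P s w ∧
        ∃ k, N ≤ k ∧ BombBilliards.DigsPeriodicTunnel w k := by
  -- `a` and `f` are the integral and the fractional part of the height at which the half-line
  -- of slope exactly `3` crosses the first vertical grid line
  obtain ⟨a, f, ha, hf0, hf1, hf⟩ : ∃ (a : ℕ) (f : ℝ), a < 4 ∧ 0 ≤ f ∧ f < 1 ∧
      P 1 + 3 * (1 - P 0) = a + f := by
    have h0 : 0 ≤ P 1 + 3 * (1 - P 0) := by linarith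
    refine ⟨⌊P 1 + 3 * (1 - P 0)⌋₊, P 1 + 3 * (1 - P 0) - ⌊P 1 + 3 * (1 - P 0)⌋₊, ?_, ?_, ?_, ?_⟩
    · rw [Nat.floor_lt h0]; push_cast; linarith
    · linarith [Nat.floor_le h0]
    · linarith [Nat.lt_floor_add_one (P 1 + 3 * (1 - P 0))]
    · ring
  obtain ⟨Q₁, hQ₁⟩ := exists_nat_gt (1 / δ)
  obtain ⟨Q₂, hQ₂⟩ := exists_nat_ge (17 / (1 - f))
  obtain ⟨q, hq₁, hq₂, hq₃, hg⟩ : ∃ q : ℕ, Q₁ ≤ q ∧ Q₂ ≤ q ∧ 24 + 3 * N ≤ q ∧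
      BombBilliards.IsGeneric (P 0) (P 1) (3 + 1 / (q : ℕ)) := by
    rcases BombBilliards.isGeneric_or hx hy (q := Q₁ + Q₂ + (24 + 3 * N)) (by omega) with h | h
    · exact ⟨_, by omega, by omega, by omega, h⟩
    · exact ⟨_, by omega, by omega, by omega, h⟩
  have hq0 : (0 : ℝ) < q := by exact_mod_cast (show 0 < q by omega)
  have hs : ((3 + 1 / q : ℚ) : ℝ) = 3 + 1 / q := by push_cast; rfl
  refine ⟨3 + 1 / q, ?_, ?_, ?_, ?_⟩
  · rw [hs]
    have : 0 < 1 / (q : ℝ) := by positivity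
    linarith
  · rw [hs]
    have h1 : 1 / δ < q := hQ₁.trans_le (by exact_mod_cast hq₁)
    have h2 := (one_div_lt hδ hq0).1 h1
    linarith
  · rw [hs]
    refine ⟨_, BombBilliards.isCuttingSequence hg, q + (3 * q + 1), by omega,
      BombBilliards.isLeastPeriod hg (p := 3 * q + 1) ?_ (by omega) ?_⟩
    · push_cast; field_simp
    · rw [show q + (3 * q + 1) = 1 + 4 * q by ring]
      simp
  · rw [hs]
    obtain ⟨j, hj, hr₀, hr⟩ := BombBilliards.reads_of_slope (by omega) hg hf0 hf (by
      have h1 : 17 / (1 - f) ≤ q := hQ₂.trans (by exact_mod_cast hq₂)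
      rwa [div_le_iff₀ (by linarith)] at h1)
    obtain ⟨D, k₀, n₀, hd⟩ := BombBilliards.digs_of_reads ha hj (by omega) hr₀ hr
    obtain ⟨k, hk, ht⟩ := BombBilliards.exists_digsPeriodicTunnel hd
    exact ⟨_, BombBilliards.isCollisionSequence hg hd.infinite, k, by omega, ht⟩
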